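/- Let $\beta = 2/\log(e/2)$. For $n\ge 2$ let $(P_e)$ be independent random variables, uniformly distributed on $[0,1]$, indexed by the edges $e$ of the complete graph on the vertex set $[n]=\{1,\dots,n\}$. The continuous random graph process is $(\mathscr G_p)_{0\le p\le 1}$, where $\mathscr G_p$ is the graph on $[n]$ whose edges are precisely the $e$ with $P_e\le p$. For a graph $G$ on $[n]$ let $\delta(G)$ be its minimum degree, $m(G)$ its number of edges and $\bar d(G)=2m(G)/(n-1)$. A sequence of events holds asymptotically almost surely (a.a.s.) if their probabilities tend to $1$ as $n\to\infty$. For all real sequences $\omega_1(n)\to\infty$ and $\omega_2(n)\to\infty$, a.a.s. both of the following hold: (i) for all $p\in[0,1]$ with $p\le \frac{\beta(\log n-\frac12\log\log n)-\omega_1(n)}{n-1}$ we have $\delta(\mathscr G_p)\le \bar d(\mathscr G_p)/2$; and (ii) for all $p\in[0,1]$ with $p\ge \frac{\beta(\log n-\frac12\log\log n)+\omega_2(n)}{n-1}$ we have $\delta(\mathscr G_p)> \bar d(\mathscr G_p)/2$. Moreover, for every constant $0<\theta<1$ there is a constant $\rho>0$ such that a.a.s. (iii) for all $\rho\log n/(n-1)\le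 p\le 1$ we have $\delta(\mathscr G_p)>\theta\,\bar d(\mathscr G_p)$. -/

import Mathlib

open MeasureTheory Filter Topology

noncomputable section

namespace RandomGraphProcess

/-- The possible edges of a graph on the vertex set `Fin n`: the edges of the complete graph. -/
abbrev Edge (n : ℕ) : Type := (⊤ : SimpleGraph (Fin n)).edgeSet

/-- The sample space: an assignment of a label `P e ∈ [0,1]` to every possible edge `e`. -/
abbrev Labels (n : ℕ) : Type := Edge n → unitInterval

/-- The probability measure on the sample space: the labels are independent and uniformly
distributed on `[0,1]`, that is, their joint law is the product of the uniform laws. -/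
def law (n : ℕ) : Measure (Labels n) :=
  Measure.pi fun _ : Edge n => (volume : Measure unitInterval)

instance (n : ℕ) : IsProbabilityMeasure (law n) := by
  unfold law; infer_instance

/-- The graph `G_p` of the continuous random graph process: its edges are precisely
the `e` with `P e ≤ p`. -/
def graph {n : ℕ} (P : Labels n) (p : unitInterval) : SimpleGraph (Fin n) :=
  SimpleGraph.fromEdgeSet {e : Sym2 (Fin n) | ∃ h : e ∈ (⊤ : SimpleGraph (Fin n)).edgeSet,
    P ⟨e, h⟩ ≤ p}

/-- The minimum degree `δ(G)`. -/
def minDeg {n : ℕ} (G : SimpleGraph (Fin n)) : ℕ := by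
  classical exact G.minDegree

/-- The quantity `d̄(G) = 2 m(G) / (n - 1)`, where `m(G)` is the number of edges of `G`. -/
def dBar {n : ℕ} (G : SimpleGraph (Fin n)) : ℝ :=
  2 * (G.edgeSet.ncard : ℝ) / ((n : ℝ) - 1)

/-- The constant `β = 2 / log (e / 2)`. -/
def β : ℝ := 2 / Real.log (Real.exp 1 / 2)

/-- The events `H n` hold asymptotically almost surely: they are (measurable) events and their
probabilities tend to `1` as `n → ∞`. -/
def AAS (H : ∀ n : ℕ, Set (Labels n)) : Prop :=
  (∀ n, MeasurableSet (H n)) ∧ Tendsto (fun n => law n (H n)) atTop (𝓝 1)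

end RandomGraphProcess

end

/-!
Write `x = (n - 1) * p` for the expected degree of a vertex. Each degree in `graph P p` is binomial
with mean `x`, and `dBar` has mean `n * p` and variance at most `4 * p`, so that by Chebyshev's
inequality it may be replaced by `x` up to a bounded error (`law_real_dBar_deviation`). By Stirling's
formula, the probability that a vertex has degree at most `x / 2 + O(1)` is of order
`exp (-(x / β)) / √x` (`exists_binomial_tail_le`, `exists_le_binomial`), since
`β⁻¹ = (1 - log 2) / 2`. Hence the expected number of such vertices is of order `exp (-(s / β))`
when `x` exceeds `critDegree n = β (log n - log log n / 2)` by `s`.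

A statement about all times reduces to times at unit distance in `x` because degrees and `dBar` increase
with `p`: while `x` grows from `y` to `y + 1`, degrees and `dBar / 2` can be compared through their
values at the two end points, and the loss of `O(1)` in the degree costs only a constant factor in
the above estimates. A union bound over unit intervals (`law_real_exists_time_le`) then produces
geometric series.

* Above `critDegree n + ω n` and up to `ρ log n`, the expected numbers of low vertices at the
  successive times add up to `O(exp (-(ω n / β)))` (`tendsto_above_critDegree`).
* Beyond `ρ log n`, a Chernoff bound beats the union bound over all vertices and intervals, for
  every factor `θ < 1` (`exists_tendsto_late`).
* Below `critDegree n - ω n` the second moment method produces a low vertex in each interval: two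
  degrees share one edge only, so the relevant events are almost independent
  (`law_real_forall_lt_openCount_le`), and the failure probabilities again form a geometric series.
  This works for `x ≥ log n / 2`; a vertex that is isolated at `x = log n / 2` takes care of all
  earlier times (`tendsto_below_critDegree`).

The process changes only at times that are labels, which makes the sets of labels in question
measurable (`measurableSet_forall_graph`).
-/

namespace RandomGraphProcess

/-! ### Degrees and edge numbers as counts of small labels -/

/-- The number of edges in the set `A` that are present in `G_p`. -/
noncomputable def openCount {n : ℕ} (A : Finset (Edge n)) (p : unitInterval) (P : Labels n) : ℕ :=
  (A.filter fun e => P e ≤ p).card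

/-- The edges of the complete graph that are incident to `v`. -/
def edgesAt {n : ℕ} (v : Fin n) : Finset (Edge n) :=
  Finset.univ.filter fun e => v ∈ e.1

lemma openCount_mono {n : ℕ} (A : Finset (Edge n)) (P : Labels n) {p q : unitInterval}
    (h : p ≤ q) : openCount A p P ≤ openCount A q P := by
  classical
  unfold openCount
  refine Finset.card_le_card fun e he => ?_
  simp only [Finset.mem_filter] at he ⊢
  exact ⟨he.1, he.2.trans h⟩

lemma openCount_subset {n : ℕ} {A B : Finset (Edge n)} (h : A ⊆ B) (p : unitInterval)
    (P : Labels n) : openCount A p P ≤ openCount B p P := by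
  classical
  unfold openCount
  exact Finset.card_le_card (Finset.filter_subset_filter _ h)

lemma mem_edgeSet_graph {n : ℕ} (P : Labels n) (p : unitInterval) (e : Sym2 (Fin n)) :
    e ∈ (graph P p).edgeSet ↔ ∃ h : e ∈ (⊤ : SimpleGraph (Fin n)).edgeSet, P ⟨e, h⟩ ≤ p := by
  unfold graph
  rw [SimpleGraph.edgeSet_fromEdgeSet]
  constructor
  · rintro ⟨h, -⟩
    exact h
  · rintro ⟨h, hp⟩
    exact ⟨⟨h, hp⟩, by simpa using h⟩

lemma ncard_edgeSet_graph {n : ℕ} (P : Labels n) (p : unitInterval) :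
    (graph P p).edgeSet.ncard = openCount Finset.univ p P := by
  classical
  unfold openCount
  rw [← Finset.card_map (Function.Embedding.subtype _), ← Set.ncard_coe_finset]
  congr 1
  ext e
  rw [mem_edgeSet_graph]
  simp

lemma degree_graph {n : ℕ} (P : Labels n) (p : unitInterval) (v : Fin n)
    [Fintype ((graph P p).neighborSet v)] :
    (graph P p).degree v = openCount (edgesAt v) p P := by
  classical
  unfold openCount edgesAt
  rw [← SimpleGraph.card_incidenceFinset_eq_degree, ← Finset.card_map (Function.Embedding.subtype _)]
  congr 1
  ext e
  rw [SimpleGraph.mem_incidenceFinset, SimpleGraph.incidenceSet, Set.mem_sep_iff,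
    mem_edgeSet_graph]
  simp only [Finset.mem_map, Finset.mem_filter, Finset.mem_univ, true_and,
    Function.Embedding.subtype_apply, Subtype.exists]
  constructor
  · rintro ⟨⟨h, hp⟩, hv⟩
    exact ⟨e, h, ⟨hv, hp⟩, rfl⟩
  · rintro ⟨a, h, ⟨hv, hp⟩, rfl⟩
    exact ⟨⟨h, hp⟩, hv⟩

lemma dBar_graph {n : ℕ} (P : Labels n) (p : unitInterval) :
    dBar (graph P p) = 2 * (openCount Finset.univ p P : ℝ) / ((n : ℝ) - 1) := by
  rw [dBar, ncard_edgeSet_graph]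

lemma dBar_mono {n : ℕ} (hn : 1 ≤ n) (P : Labels n) {p q : unitInterval} (h : p ≤ q) :
    dBar (graph P p) ≤ dBar (graph P q) := by
  rw [dBar_graph, dBar_graph]
  have : (1 : ℝ) ≤ n := by exact_mod_cast hn
  have : (openCount Finset.univ p P : ℝ) ≤ openCount Finset.univ q P := by
    exact_mod_cast openCount_mono _ _ h
  gcongr

lemma dBar_nonneg {n : ℕ} (hn : 1 ≤ n) (P : Labels n) (p : unitInterval) :
    0 ≤ dBar (graph P p) := by
  rw [dBar_graph]
  have : (1 : ℝ) ≤ n := by exact_mod_cast hn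
  exact div_nonneg (by positivity) (by linarith)

lemma minDeg_graph_le {n : ℕ} (P : Labels n) (p : unitInterval) (v : Fin n) :
    minDeg (graph P p) ≤ openCount (edgesAt v) p P := by
  classical
  rw [minDeg, ← degree_graph]
  exact SimpleGraph.minDegree_le_degree _ v

lemma lt_minDeg_graph {n : ℕ} (hn : 1 ≤ n) (P : Labels n) (p : unitInterval) {t : ℝ}
    (h : ∀ v, t < openCount (edgesAt v) p P) : t < minDeg (graph P p) := by
  classical
  have : Nonempty (Fin n) := ⟨⟨0, hn⟩⟩
  obtain ⟨v, hv⟩ := (graph P p).exists_minimal_degree_vertex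
  have := h v
  rw [← degree_graph, ← hv] at this
  exact this

lemma card_edgesAt {n : ℕ} (v : Fin n) : (edgesAt v).card = n - 1 := by
  classical
  have h := degree_graph (n := n) (fun _ => 0) 0 v
  have h2 : graph (n := n) (fun _ => 0) 0 = ⊤ := by
    rw [← SimpleGraph.edgeSet_inj]
    ext e
    rw [mem_edgeSet_graph]
    simp
  have h3 : openCount (n := n) (edgesAt v) 0 (fun _ => 0) = (edgesAt v).card := by
    simp [openCount]
  rw [h3] at h
  have h4 : ∀ (G : SimpleGraph (Fin n)) [Fintype (G.neighborSet v)], G = ⊤ →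
      G.degree v = n - 1 := by
    rintro G _ rfl
    have h5 := SimpleGraph.complete_graph_degree (V := Fin n) v
    rw [Fintype.card_fin] at h5
    rw [← h5]
    unfold SimpleGraph.degree SimpleGraph.neighborFinset
    congr!
  rw [← h, h4 _ h2]

lemma card_edges (n : ℕ) : (Finset.univ : Finset (Edge n)).card = n.choose 2 := by
  classical
  have := SimpleGraph.card_edgeFinset_top_eq_card_choose_two (V := Fin n)
  rw [Fintype.card_fin] at this
  rw [← this, SimpleGraph.edgeFinset_card, Finset.card_univ]

lemma edgesAt_inter {n : ℕ} {v w : Fin n} (h : v ≠ w) :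
    edgesAt v ∩ edgesAt w = {⟨s(v, w), by simpa using h⟩} := by
  ext ⟨e, he⟩
  simp only [edgesAt, Finset.mem_inter, Finset.mem_filter, Finset.mem_univ, true_and,
    Finset.mem_singleton, Subtype.mk.injEq]
  exact Sym2.mem_and_mem_iff h

/-! ### Measurability -/

/-- Each `f e` is an event, and `R` is any condition on which of these finitely many events occur. -/
lemma measurableSet_preimage_pattern {n : ℕ} (f : Edge n → Labels n → Prop)
    (hf : ∀ e, MeasurableSet {P | f e P}) (R : (Edge n → Prop) → Prop) :
    MeasurableSet {P | R fun e => f e P} := by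
  have hm : Measurable fun P : Labels n => fun e => f e P :=
    measurable_pi_lambda _ fun e => measurableSet_setOfPred.mp (hf e)
  exact hm (MeasurableSet.of_discrete (s := {g | R g}))

lemma graph_congr {n : ℕ} {P Q : Labels n} {p q : unitInterval}
    (h : ∀ e, P e ≤ p ↔ Q e ≤ q) : graph P p = graph Q q := by
  rw [← SimpleGraph.edgeSet_inj]
  ext e
  simp only [mem_edgeSet_graph, h]

lemma measurableSet_openCount {n : ℕ} (A : Finset (Edge n)) (p : unitInterval) (R : ℕ → Prop) :
    MeasurableSet {P : Labels n | R (openCount A p P)} := by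
  classical
  have := measurableSet_preimage_pattern (n := n) (fun e P => P e ≤ p)
    (fun e => measurableSet_le (measurable_pi_apply e) measurable_const)
    (fun g => R (A.filter g).card)
  exact this

/-- A property that holds along the process at all times of an interval with a least element is
an event: the process changes only at times that are labels, so that it suffices to look at
the initial time and at the labels. -/
lemma measurableSet_forall_graph {n : ℕ} (S : Set unitInterval) (hS : S.OrdConnected)
    {s₀ : unitInterval} (hs : IsLeast S s₀) (Q : SimpleGraph (Fin n) → Prop) :
    MeasurableSet {P : Labels n | ∀ p ∈ S, Q (graph P p)} := by
  classical
  have key : {P : Labels n | ∀ p ∈ S, Q (graph P p)} =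
      {P | Q (graph P s₀)} ∩ ⋂ e : Edge n, {P | P e ∈ S}ᶜ ∪ {P | Q (graph P (P e))} := by
    ext P
    simp only [Set.mem_ofPred_eq, Set.mem_inter_iff, Set.mem_iInter, Set.mem_union,
      Set.mem_compl_iff]
    constructor
    · exact fun h => ⟨h _ hs.1, fun e => or_iff_not_imp_left.2 fun he => h _ (not_not.1 he)⟩
    · rintro ⟨h0, h1⟩ p hp
      -- the last time up to `p` at which the process starts or jumps
      set T : Finset unitInterval :=
        insert s₀ ((Finset.univ.filter fun e => P e ≤ p).image P) with hT
      have hne : T.Nonempty := ⟨s₀, Finset.mem_insert_self _ _⟩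
      have hmem := T.max'_mem hne
      set m := T.max' hne with hm
      have hs₀m : s₀ ≤ m := T.le_max' _ (Finset.mem_insert_self _ _)
      have hmp : m ≤ p := by
        refine T.max'_le hne _ fun y hy => ?_
        rw [hT, Finset.mem_insert] at hy
        rcases hy with rfl | hy
        · exact hs.2 hp
        · simp only [Finset.mem_image, Finset.mem_filter] at hy
          obtain ⟨e, he, rfl⟩ := hy
          exact he.2
      have hmS : m ∈ S := hS.out hs.1 hp ⟨hs₀m, hmp⟩
      have hg : graph P p = graph P m := by
        refine graph_congr fun e => ⟨fun he => T.le_max' _ ?_, fun he => he.trans hmp⟩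
        exact Finset.mem_insert_of_mem (Finset.mem_image_of_mem _ (by simpa using he))
      rw [hg]
      rw [hT, Finset.mem_insert] at hmem
      rcases hmem with hmem | hmem
      · rw [hmem]; exact h0
      · simp only [Finset.mem_image] at hmem
        obtain ⟨e, -, he⟩ := hmem
        rcases h1 e with h | h
        · exact absurd (he ▸ hmS) h
        · rwa [he] at h
  -- `graph P p` is a function of the set of edges with label at most `p`
  have gr : ∀ g : Edge n → Prop, ∃ G : SimpleGraph (Fin n), ∀ (P : Labels n) p,
      (fun e => P e ≤ p) = g → graph P p = G := by
    intro g
    by_cases h : ∃ (P : Labels n) (p : unitInterval), (fun e => P e ≤ p) = g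
    · obtain ⟨P, p, h⟩ := h
      exact ⟨graph P p, fun P' p' h' => graph_congr fun e => by
        rw [← h] at h'; exact iff_of_eq (congrFun h' e)⟩
    · exact ⟨⊥, fun P p h' => absurd ⟨P, p, h'⟩ h⟩
  choose G hG using gr
  rw [key]
  refine MeasurableSet.inter ?_ (MeasurableSet.iInter fun e => ?_)
  · have := measurableSet_preimage_pattern (n := n) (fun e P => P e ≤ s₀)
      (fun e => measurableSet_le (measurable_pi_apply e) measurable_const) (fun g => Q (G g))
    convert this using 3 with P
    exact iff_of_eq (congrArg Q (hG _ _ _ rfl))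
  · refine ((measurable_pi_apply e) hS.measurableSet).compl.union ?_
    have := measurableSet_preimage_pattern (n := n) (fun e' P => P e' ≤ P e)
      (fun e' => measurableSet_le (measurable_pi_apply e') (measurable_pi_apply e))
      (fun g => Q (G g))
    convert this using 3 with P
    exact iff_of_eq (congrArg Q (hG _ _ _ rfl))

lemma measurableSet_forall_ge {n : ℕ} (c : ℝ) (Q : SimpleGraph (Fin n) → Prop) :
    MeasurableSet {P : Labels n | ∀ p : unitInterval, c ≤ (p : ℝ) → Q (graph P p)} := by
  by_cases hc : c ≤ 1
  · have hs : IsLeast {p : unitInterval | c ≤ (p : ℝ)} ⟨max c 0, by simp, by simp [hc]⟩ :=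
      ⟨by simp, fun p hp => Subtype.coe_le_coe.1 (max_le hp p.2.1)⟩
    exact measurableSet_forall_graph {p : unitInterval | c ≤ (p : ℝ)}
      ⟨fun x hx y hy z hz => le_trans (b := (x : ℝ)) hx hz.1⟩ hs Q
  · convert MeasurableSet.univ
    ext P
    simp only [Set.mem_ofPred_eq, Set.mem_univ, iff_true]
    exact fun p hp => absurd (hp.trans p.2.2) hc

lemma measurableSet_forall_le {n : ℕ} (c : ℝ) (Q : SimpleGraph (Fin n) → Prop) :
    MeasurableSet {P : Labels n | ∀ p : unitInterval, (p : ℝ) ≤ c → Q (graph P p)} := by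
  by_cases hc : 0 ≤ c
  · have hs : IsLeast {p : unitInterval | (p : ℝ) ≤ c} 0 :=
      ⟨by simpa using hc, fun p _ => p.2.1⟩
    exact measurableSet_forall_graph {p : unitInterval | (p : ℝ) ≤ c}
      ⟨fun x hx y hy z hz => le_trans (Subtype.coe_le_coe.2 hz.2) hy⟩ hs Q
  · convert MeasurableSet.univ
    ext P
    simp only [Set.mem_ofPred_eq, Set.mem_univ, iff_true]
    exact fun p hp => absurd (p.2.1.trans hp) hc

/-! ### Binomial laws, independence and concentration at a fixed time -/

/-- The probability that exactly the edges of `S` are present among the edges of `A`. -/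
lemma law_real_pattern {n : ℕ} (A S : Finset (Edge n)) (hS : S ⊆ A) (p : unitInterval) :
    (law n).real {P | ∀ e ∈ A, P e ≤ p ↔ e ∈ S} =
      (p : ℝ) ^ S.card * (1 - p) ^ (A.card - S.card) := by
  classical
  have h : {P : Labels n | ∀ e ∈ A, P e ≤ p ↔ e ∈ S} = Set.pi Set.univ fun e =>
      if e ∈ A then (if e ∈ S then Set.Iic p else Set.Ioi p) else Set.univ := by
    ext P
    simp only [Set.mem_ofPred_eq, Set.mem_pi, Set.mem_univ, true_imp_iff]
    refine forall_congr' fun e => ?_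
    split_ifs with h1 h2 <;> simp [*]
  have hp0 := p.2.1
  have hp1 := p.2.2
  have hr : ∀ e : Edge n, ((volume : Measure unitInterval)
      (if e ∈ A then (if e ∈ S then Set.Iic p else Set.Ioi p) else Set.univ)).toReal =
      if e ∈ A then (if e ∈ S then (p : ℝ) else 1 - p) else 1 := by
    intro e
    split_ifs
    · rw [unitInterval.volume_Iic, ENNReal.toReal_ofReal hp0]
    · rw [unitInterval.volume_Ioi, ENNReal.toReal_ofReal (by linarith)]
    · simp
  rw [h, Measure.real, law, Measure.pi_pi, ENNReal.toReal_prod]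
  simp_rw [hr]
  rw [Finset.prod_ite_mem, Finset.univ_inter, Finset.prod_ite, Finset.prod_const,
    Finset.prod_const, Finset.filter_mem_eq_inter, Finset.inter_eq_right.2 hS,
    Finset.filter_notMem_eq_sdiff, Finset.card_sdiff_of_subset hS]

lemma measurableSet_pattern {n : ℕ} (A S : Finset (Edge n)) (p : unitInterval) :
    MeasurableSet {P : Labels n | ∀ e ∈ A, P e ≤ p ↔ e ∈ S} :=
  measurableSet_preimage_pattern (n := n) (fun e P => P e ≤ p)
    (fun e => measurableSet_le (measurable_pi_apply e) measurable_const)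
    (fun g => ∀ e ∈ A, g e ↔ e ∈ S)

lemma law_real_openCount_eq {n : ℕ} (A : Finset (Edge n)) (p : unitInterval) (k : ℕ) :
    (law n).real {P | openCount A p P = k} =
      (A.card.choose k : ℝ) * (p : ℝ) ^ k * (1 - p) ^ (A.card - k) := by
  classical
  have h : {P : Labels n | openCount A p P = k} =
      ⋃ S ∈ A.powersetCard k, {P | ∀ e ∈ A, P e ≤ p ↔ e ∈ S} := by
    ext P
    simp only [Set.mem_ofPred_eq, Set.mem_iUnion, Finset.mem_powersetCard, exists_prop]
    constructor
    · intro hk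
      exact ⟨A.filter fun e => P e ≤ p, ⟨Finset.filter_subset _ _, hk⟩,
        fun e he => by simp [he]⟩
    · rintro ⟨S, ⟨hS, rfl⟩, hP⟩
      unfold openCount
      congr 1
      ext e
      rw [Finset.mem_filter]
      exact ⟨fun he => (hP e he.1).1 he.2, fun he => ⟨hS he, (hP e (hS he)).2 he⟩⟩
  rw [h, measureReal_biUnion_finset]
  · rw [Finset.sum_congr rfl fun S hS => ?_, Finset.sum_const, Finset.card_powersetCard,
      nsmul_eq_mul, mul_assoc]
    rw [Finset.mem_powersetCard] at hS
    rw [law_real_pattern A S hS.1, hS.2]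
  · intro S hS T hT hne
    refine Set.disjoint_left.2 fun P hPS hPT => hne ?_
    have hS := (Finset.mem_powersetCard.1 (Finset.mem_coe.1 hS)).1
    have hT := (Finset.mem_powersetCard.1 (Finset.mem_coe.1 hT)).1
    rw [Set.mem_ofPred_eq] at hPS hPT
    ext e
    exact ⟨fun he => (hPT e (hS he)).1 ((hPS e (hS he)).2 he),
      fun he => (hPS e (hT he)).1 ((hPT e (hT he)).2 he)⟩
  · exact fun S _ => measurableSet_pattern A S p

lemma law_real_openCount_le {n : ℕ} (A : Finset (Edge n)) (p : unitInterval) (k : ℕ) :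
    (law n).real {P | openCount A p P ≤ k} = ∑ j ∈ Finset.range (k + 1),
      (A.card.choose j : ℝ) * (p : ℝ) ^ j * (1 - p) ^ (A.card - j) := by
  have h : {P : Labels n | openCount A p P ≤ k} =
      ⋃ j ∈ Finset.range (k + 1), {P | openCount A p P = j} := by
    ext P
    simp
  rw [h, measureReal_biUnion_finset]
  · exact Finset.sum_congr rfl fun j _ => law_real_openCount_eq A p j
  · intro i _ j _ hne
    exact Set.disjoint_left.2 fun P hi hj => hne (hi.symm.trans hj)
  · exact fun j _ => measurableSet_openCount A p (· = j)

lemma law_real_inter_of_disjoint {n : ℕ} {A B : Finset (Edge n)} (h : Disjoint A B)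
    (p : unitInterval) (R R' : ℕ → Prop) :
    (law n).real ({P | R (openCount A p P)} ∩ {P | R' (openCount B p P)}) =
      (law n).real {P | R (openCount A p P)} * (law n).real {P | R' (openCount B p P)} := by
  classical
  have hm : Measurable fun u : unitInterval => u ≤ p :=
    measurableSet_setOfPred.mp measurableSet_Iic
  have hind : ProbabilityTheory.iIndepFun (fun (e : Edge n) (P : Labels n) => P e ≤ p) (law n) :=
    ProbabilityTheory.iIndepFun_pi (X := fun _ u => u ≤ p) fun _ => hm.aemeasurable
  have h2 := hind.indepFun_finset A B h fun e => hm.comp (measurable_pi_apply e)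
  have hc : ∀ (C : Finset (Edge n)) (P : Labels n),
      openCount C p P = ((Finset.univ : Finset C).filter fun i : C => P i ≤ p).card := by
    intro C P
    rw [openCount, Finset.card_filter, Finset.card_filter,
      Finset.sum_coe_sort C fun e => if P e ≤ p then 1 else 0]
  have h3 := h2.measure_inter_preimage_eq_mul
    {g | R ((Finset.univ : Finset A).filter fun i => g i).card}
    {g | R' ((Finset.univ : Finset B).filter fun i => g i).card}
    MeasurableSet.of_discrete MeasurableSet.of_discrete
  have h4 := congrArg ENNReal.toReal h3
  rw [ENNReal.toReal_mul] at h4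
  simp_rw [hc]
  exact h4

/-- The number of edges has expectation `p * n.choose 2` and at most that variance, so Chebyshev's
inequality shows that `dBar` is close to its mean `n * p`. -/
lemma law_real_dBar_deviation {n : ℕ} (hn : 2 ≤ n) (p : unitInterval) {t : ℝ} (ht : 0 < t) :
    (law n).real {P | t ≤ |dBar (graph P p) - n * p|} ≤ 4 * p / t ^ 2 := by
  classical
  set X : unitInterval → ℝ := Set.indicator (Set.Iic p) 1 with hX
  have hXm : Measurable X := measurable_one.indicator measurableSet_Iic
  have hXL : MemLp X 2 (volume : Measure unitInterval) :=
    MemLp.of_bound hXm.aestronglyMeasurable 1 (Filter.Eventually.of_forall fun u => by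
      rw [hX, Set.indicator_apply]; split_ifs <;> simp)
  have hp0 := p.2.1
  have hp1 := p.2.2
  have hint : ∫ u, X u = p := by
    rw [hX, integral_indicator_one measurableSet_Iic, Measure.real, unitInterval.volume_Iic,
      ENNReal.toReal_ofReal hp0]
  have hvar : ProbabilityTheory.variance X volume ≤ p := by
    rw [ProbabilityTheory.variance_eq_sub hXL, hint]
    have : X ^ 2 = X := by
      ext u
      simp [hX, Set.indicator_apply]
    rw [this, hint]
    nlinarith
  set Y : Labels n → ℝ := ∑ e, fun P => X (P e) with hY
  have hYc : ∀ P, Y P = openCount Finset.univ p P := by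
    intro P
    rw [hY, Finset.sum_apply, openCount, Finset.card_filter]
    push_cast
    refine Finset.sum_congr rfl fun e _ => ?_
    simp [hX, Set.indicator_apply]
  have hXe : ∀ e : Edge n, MemLp (fun P : Labels n => X (P e)) 2 (law n) := fun e =>
    hXL.comp_measurePreserving (measurePreserving_eval (fun _ : Edge n => volume) e)
  have hYvar : ProbabilityTheory.variance Y (law n) ≤ (n.choose 2 : ℝ) * p := by
    have := ProbabilityTheory.variance_sum_pi (ι := Edge n)
      (μ := fun _ => (volume : Measure unitInterval)) (X := fun _ => X) fun _ => hXL
    rw [hY, law, this, ← card_edges, ← nsmul_eq_mul]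
    exact Finset.sum_le_card_nsmul _ _ _ fun _ _ => hvar
  have hYL : MemLp Y 2 (law n) := memLp_finsetSum' _ fun e _ => hXe e
  have hYint : ∫ P, Y P ∂(law n) = (n.choose 2 : ℝ) * p := by
    simp_rw [hY, Finset.sum_apply]
    rw [integral_finsetSum _ fun e _ => (hXe e).integrable (by norm_num)]
    rw [← card_edges, ← nsmul_eq_mul, ← Finset.sum_const]
    refine Finset.sum_congr rfl fun e _ => ?_
    rw [← hint]
    exact integral_comp_eval hXm.aestronglyMeasurable
  have hn' : (2 : ℝ) ≤ n := by exact_mod_cast hn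
  have hc : 0 < t * ((n : ℝ) - 1) / 2 := by
    have : 0 < (n : ℝ) - 1 := by linarith
    positivity
  have hsub : {P | t ≤ |dBar (graph P p) - n * p|} ⊆
      {P | t * ((n : ℝ) - 1) / 2 ≤ |Y P - ∫ P, Y P ∂(law n)|} := by
    intro P hP
    rw [Set.mem_ofPred_eq] at hP ⊢
    rw [hYint, hYc, Nat.cast_choose_two]
    rw [dBar_graph] at hP
    have h1 : 2 * (openCount Finset.univ p P : ℝ) / ((n : ℝ) - 1) - n * p =
        2 / ((n : ℝ) - 1) * ((openCount Finset.univ p P : ℝ) - n * (n - 1) / 2 * p) := by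
      have : (n : ℝ) - 1 ≠ 0 := by linarith
      field_simp
    have h2 : 0 < 2 / ((n : ℝ) - 1) := by
      have : 0 < (n : ℝ) - 1 := by linarith
      positivity
    rw [h1, abs_mul, abs_of_pos h2, ← div_le_iff₀' h2] at hP
    refine le_trans (le_of_eq ?_) hP
    rw [div_div_eq_mul_div]
  refine (measureReal_mono hsub).trans ?_
  have h3 := ProbabilityTheory.meas_ge_le_variance_div_sq hYL hc
  refine (ENNReal.toReal_le_of_le_ofReal
    (div_nonneg (ProbabilityTheory.variance_nonneg _ _) (sq_nonneg _)) h3).trans ?_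
  have hn1 : 0 < (n : ℝ) - 1 := by linarith
  refine (div_le_div_of_nonneg_right hYvar (sq_nonneg _)).trans ?_
  rw [Nat.cast_choose_two, div_le_div_iff₀ (by positivity) (by positivity)]
  have h5 : (n : ℝ) * (n - 1) / 2 * p * t ^ 2 ≤ (n - 1) ^ 2 * (p * t ^ 2) := by
    have h6 : (n : ℝ) * (n - 1) / 2 ≤ (n - 1) ^ 2 := by nlinarith
    have h7 : 0 ≤ (p : ℝ) * t ^ 2 := by positivity
    nlinarith
  linarith

/-- The second moment method: events `A i` of equal probability that are almost uncorrelated are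
unlikely to fail all together. -/
lemma real_iInter_compl_le {Ω ι : Type*} [MeasurableSpace Ω] [Fintype ι] (μ : Measure Ω)
    [IsProbabilityMeasure μ] (A : ι → Set Ω) (hA : ∀ i, MeasurableSet (A i)) {a ε : ℝ}
    (ha : 0 < a) (hε : 0 ≤ ε) [Nonempty ι] (h1 : ∀ i, μ.real (A i) = a)
    (h2 : ∀ i j, i ≠ j → μ.real (A i ∩ A j) ≤ (1 + ε) * a ^ 2) :
    μ.real (⋂ i, (A i)ᶜ) ≤ 1 / (Fintype.card ι * a) + ε := by
  classical
  set s : ℝ := (Fintype.card ι : ℝ) with hs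
  have hs0 : 0 < s := Nat.cast_pos.2 Fintype.card_pos
  have hint1 : ∀ B : Set Ω, MeasurableSet B → Integrable (B.indicator (1 : Ω → ℝ)) μ :=
    fun B hB => (integrable_const (1 : ℝ)).indicator hB
  set X : Ω → ℝ := fun ω => ∑ i, (A i).indicator 1 ω with hX
  have hXi : Integrable X μ := integrable_finsetSum _ fun i _ => hint1 _ (hA i)
  have hXint : ∫ ω, X ω ∂μ = s * a := by
    rw [hX, integral_finsetSum _ fun i _ => hint1 _ (hA i)]
    simp_rw [integral_indicator_one (hA _), h1]
    simp [hs]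
  have hX2 : (fun ω => X ω ^ 2) = fun ω => ∑ i, ∑ j, (A i ∩ A j).indicator 1 ω := by
    ext ω
    rw [hX, sq, Finset.sum_mul_sum]
    refine Finset.sum_congr rfl fun i _ => Finset.sum_congr rfl fun j _ => ?_
    rw [Set.inter_indicator_one]
    rfl
  have hX2i : Integrable (fun ω => X ω ^ 2) μ := by
    rw [hX2]
    exact integrable_finsetSum _ fun i _ => integrable_finsetSum _ fun j _ =>
      hint1 _ ((hA i).inter (hA j))
  have hX2int : ∫ ω, X ω ^ 2 ∂μ ≤ s * a + (1 + ε) * (s * a) ^ 2 := by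
    rw [hX2, integral_finsetSum _ fun i _ => integrable_finsetSum _ fun j _ =>
      hint1 _ ((hA i).inter (hA j))]
    have hi : ∀ i, ∫ ω, ∑ j, (A i ∩ A j).indicator 1 ω ∂μ ≤ a + s * ((1 + ε) * a ^ 2) := by
      intro i
      rw [integral_finsetSum _ fun j _ => hint1 _ ((hA i).inter (hA j))]
      simp_rw [integral_indicator_one ((hA _).inter (hA _))]
      calc ∑ j, μ.real (A i ∩ A j) ≤ ∑ j, ((if i = j then a else 0) + (1 + ε) * a ^ 2) := by
            refine Finset.sum_le_sum fun j _ => ?_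
            split_ifs with hij
            · subst hij
              rw [Set.inter_self, h1]
              have : 0 ≤ (1 + ε) * a ^ 2 := by positivity
              linarith
            · rw [zero_add]
              exact h2 i j hij
        _ = _ := by simp [Finset.sum_add_distrib, hs]
    calc _ ≤ ∑ _i : ι, (a + s * ((1 + ε) * a ^ 2)) := Finset.sum_le_sum fun i _ => hi i
      _ = s * (a + s * ((1 + ε) * a ^ 2)) := by rw [Finset.sum_const, nsmul_eq_mul]; simp [hs]
      _ = _ := by ring
  have hB : MeasurableSet (⋂ i, (A i)ᶜ) := MeasurableSet.iInter fun i => (hA i).compl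
  have hle : ∫ ω, (s * a) ^ 2 * (⋂ i, (A i)ᶜ).indicator 1 ω ∂μ ≤
      ∫ ω, (X ω ^ 2 - 2 * (s * a) * X ω + (s * a) ^ 2) ∂μ := by
    refine integral_mono ((hint1 _ hB).const_mul _)
      ((hX2i.sub (hXi.const_mul _)).add (integrable_const _)) fun ω => ?_
    by_cases hω : ω ∈ ⋂ i, (A i)ᶜ
    · have h0 : X ω = 0 := by
        rw [hX]
        refine Finset.sum_eq_zero fun i _ => Set.indicator_of_notMem ?_ _
        exact Set.mem_iInter.1 hω i
      simp [hω, h0]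
    · simp only [Set.indicator_of_notMem hω, mul_zero]
      nlinarith [sq_nonneg (X ω - s * a)]
  have hsplit : ∫ ω, (X ω ^ 2 - 2 * (s * a) * X ω + (s * a) ^ 2) ∂μ =
      ∫ ω, X ω ^ 2 ∂μ - 2 * (s * a) * (s * a) + (s * a) ^ 2 := by
    rw [integral_add (f := fun ω => X ω ^ 2 - 2 * (s * a) * X ω) (hX2i.sub (hXi.const_mul _))
      (integrable_const _), integral_sub hX2i (hXi.const_mul _), integral_const_mul, hXint,
      integral_const]
    simp
  rw [integral_const_mul, integral_indicator_one hB, hsplit] at hle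
  have hsa : 0 < s * a := by positivity
  have h3 : (s * a) ^ 2 * μ.real (⋂ i, (A i)ᶜ) ≤ s * a + ε * (s * a) ^ 2 := by nlinarith
  have h4 : (s * a) ^ 2 * (1 / (s * a) + ε) = s * a + ε * (s * a) ^ 2 := by
    field_simp
  rw [← h4] at h3
  exact le_of_mul_le_mul_left h3 (by positivity)

/-- The degrees of two vertices depend on a common edge only, which makes the events
that they are at most `k` almost independent: both imply that the degree without the
common edge is at most `k`, and this changes the probability by a factor of at most
`1 / (1 - p)`. -/
lemma law_real_forall_lt_openCount_le {n : ℕ} (hn : 1 ≤ n) (p : unitInterval)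
    (hp : (p : ℝ) ≤ 1 / 4) (k : ℕ) {a₀ : ℝ} (ha₀ : 0 < a₀)
    (ha : ∀ v : Fin n, a₀ ≤ (law n).real {P | openCount (edgesAt v) p P ≤ k}) :
    (law n).real {P | ∀ v : Fin n, k < openCount (edgesAt v) p P} ≤ 1 / (n * a₀) + 6 * p := by
  classical
  have : Nonempty (Fin n) := ⟨⟨0, hn⟩⟩
  have hp0 := p.2.1
  set a := (law n).real {P | openCount (edgesAt (⟨0, hn⟩ : Fin n)) p P ≤ k} with hadef
  have hav : ∀ v : Fin n, (law n).real {P | openCount (edgesAt v) p P ≤ k} = a := by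
    intro v
    rw [hadef, law_real_openCount_le, law_real_openCount_le, card_edgesAt, card_edgesAt]
  have haa : a₀ ≤ a := ha _
  have h := real_iInter_compl_le (law n) (fun v : Fin n => {P | openCount (edgesAt v) p P ≤ k})
    (fun v => measurableSet_openCount _ p (· ≤ k)) (a := a) (ε := 6 * p) (ha₀.trans_le haa)
    (by positivity) hav ?_
  · have hset : (⋂ v : Fin n, {P | openCount (edgesAt v) p P ≤ k}ᶜ) =
        {P | ∀ v : Fin n, k < openCount (edgesAt v) p P} := by
      ext P
      simp
    rw [hset, Fintype.card_fin] at h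
    refine h.trans ?_
    have : (0 : ℝ) < n := by exact_mod_cast hn
    gcongr
  · intro v w hvw
    obtain ⟨e, he⟩ : ∃ e, edgesAt v ∩ edgesAt w = {e} := ⟨_, edgesAt_inter hvw⟩
    have hev : e ∈ edgesAt v := (Finset.mem_inter.1 (he ▸ Finset.mem_singleton_self e)).1
    have hew : e ∈ edgesAt w := (Finset.mem_inter.1 (he ▸ Finset.mem_singleton_self e)).2
    set q := (law n).real {P | openCount ((edgesAt v).erase e) p P ≤ k} with hq
    have hqw : (law n).real {P | openCount ((edgesAt w).erase e) p P ≤ k} = q := by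
      rw [hq, law_real_openCount_le, law_real_openCount_le, Finset.card_erase_of_mem hev,
        Finset.card_erase_of_mem hew, card_edgesAt, card_edgesAt]
    have hdis : Disjoint ((edgesAt v).erase e) ((edgesAt w).erase e) := by
      rw [Finset.disjoint_left]
      intro f hf hf'
      have : f ∈ edgesAt v ∩ edgesAt w :=
        Finset.mem_inter.2 ⟨Finset.mem_of_mem_erase hf, Finset.mem_of_mem_erase hf'⟩
      rw [he, Finset.mem_singleton] at this
      exact Finset.ne_of_mem_erase hf this
    have h1 : (law n).real ({P | openCount (edgesAt v) p P ≤ k} ∩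
        {P | openCount (edgesAt w) p P ≤ k}) ≤ q ^ 2 := by
      rw [sq]
      nth_rewrite 2 [← hqw]
      rw [hq, ← law_real_inter_of_disjoint hdis p (· ≤ k) (· ≤ k)]
      refine measureReal_mono fun P hP => ⟨?_, ?_⟩
      · exact (openCount_subset (Finset.erase_subset _ _) p P).trans hP.1
      · exact (openCount_subset (Finset.erase_subset _ _) p P).trans hP.2
    -- if the common edge is absent, the degree is the degree without it
    have h2 : q * (1 - p) ≤ a := by
      have h3 : (law n).real {P | openCount {e} p P = 0} = 1 - p := by
        rw [law_real_openCount_eq]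
        simp
      rw [← hav v, ← h3, hq, ← law_real_inter_of_disjoint
        (by simp : Disjoint ((edgesAt v).erase e) {e}) p (· ≤ k) (· = 0)]
      refine measureReal_mono fun P hP => ?_
      obtain ⟨hP1, hP2⟩ := hP
      rw [Set.mem_ofPred_eq] at hP1 hP2 ⊢
      refine le_trans (le_of_eq ?_) hP1
      unfold openCount at hP2 ⊢
      rw [← Finset.insert_erase hev, Finset.filter_insert, Finset.erase_insert_eq_erase,
        Finset.erase_idem, if_neg]
      intro h
      rw [Finset.card_eq_zero, Finset.filter_eq_empty_iff] at hP2
      exact hP2 (Finset.mem_singleton_self e) h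
    have hq0 : 0 ≤ q := measureReal_nonneg
    refine h1.trans ?_
    have h4 : (q * (1 - p)) ^ 2 ≤ a ^ 2 :=
      pow_le_pow_left₀ (mul_nonneg hq0 (by linarith)) h2 2
    have h5 : 1 ≤ (1 + 6 * (p : ℝ)) * (1 - p) ^ 2 := by nlinarith [mul_nonneg hp0 hp0]
    calc q ^ 2 ≤ q ^ 2 * ((1 + 6 * (p : ℝ)) * (1 - p) ^ 2) :=
          le_mul_of_one_le_right (sq_nonneg q) h5
      _ = (1 + 6 * p) * (q * (1 - p)) ^ 2 := by ring
      _ ≤ _ := by gcongr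

/-! ### Estimates for the lower tail of the binomial distribution -/

lemma inv_β : β⁻¹ = (1 - Real.log 2) / 2 := by
  rw [β, inv_div, Real.log_div (Real.exp_ne_zero 1) two_ne_zero, Real.log_exp]

lemma β_pos : 0 < β := by
  rw [← inv_pos, inv_β]
  linarith [Real.log_two_lt_d9]

lemma β_lt_seven : β < 7 := by
  rw [← inv_inv β, inv_β, inv_lt_comm₀ _ (by norm_num)]
  · linarith [Real.log_two_lt_d9]
  · linarith [Real.log_two_lt_d9]

lemma two_lt_β : 2 < β := by
  rw [← inv_inv β, inv_β, lt_inv_comm₀ (by norm_num)]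
  · linarith [Real.log_two_gt_d9]
  · linarith [Real.log_two_lt_d9]

lemma sqrt_mul_pow_le_factorial (k : ℕ) :
    √(k : ℝ) * (k / Real.exp 1) ^ k ≤ (k.factorial : ℝ) := by
  refine le_trans ?_ (Stirling.le_factorial_stirling k)
  gcongr
  have h1 : (0 : ℝ) ≤ k := by positivity
  nlinarith [Real.pi_gt_three]

lemma factorial_le_sqrt_mul_pow {k : ℕ} (hk : 1 ≤ k) :
    (k.factorial : ℝ) ≤ Real.exp 1 * √(k : ℝ) * (k / Real.exp 1) ^ k := by
  obtain ⟨m, rfl⟩ : ∃ m, k = m + 1 := ⟨k - 1, by omega⟩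
  have h := Stirling.stirlingSeq'_antitone (Nat.zero_le m)
  simp only [Function.comp, Nat.succ_eq_add_one, zero_add, Stirling.stirlingSeq_one] at h
  rw [Stirling.stirlingSeq, div_le_iff₀ (by positivity)] at h
  refine h.trans (le_of_eq ?_)
  rw [Real.sqrt_mul (by norm_num)]
  have : √(2 : ℝ) ≠ 0 := by positivity
  field_simp

lemma mul_div_pow_eq {x : ℝ} {k : ℕ} (hk : 1 ≤ k) :
    x ^ k = (Real.exp 1 * (x / k)) ^ k * (k / Real.exp 1) ^ k := by
  rw [← mul_pow]
  congr 1
  have : (k : ℝ) ≠ 0 := by positivity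
  field_simp

lemma two_exp_pow (k : ℕ) :
    (Real.exp 1 * 2) ^ k = Real.exp (k * (1 + Real.log 2)) := by
  rw [Real.exp_nat_mul, Real.exp_add, Real.exp_log two_pos]

/-- Below the mean the terms `x ^ j / j!` grow geometrically. -/
lemma sum_pow_div_factorial_le {x : ℝ} (hx : 0 < x) (k : ℕ) (hk : (k : ℝ) ≤ 3 / 4 * x) :
    ∑ j ∈ Finset.range (k + 1), x ^ j / (j.factorial : ℝ) ≤ 4 * (x ^ k / (k.factorial : ℝ)) := by
  induction k with
  | zero => simp
  | succ k ih =>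
    push_cast at hk
    rw [Finset.sum_range_succ]
    have h1 := ih (by linarith)
    have h2 : x ^ k / (k.factorial : ℝ) ≤ 3 / 4 * (x ^ (k + 1) / ((k + 1).factorial : ℝ)) := by
      rw [Nat.factorial_succ, pow_succ]
      push_cast
      have h3 : 0 < x ^ k / (k.factorial : ℝ) := by positivity
      have h4 : 3 / 4 * (x ^ k * x / (((k : ℝ) + 1) * (k.factorial : ℝ))) =
          x ^ k / (k.factorial : ℝ) * (3 / 4 * x / (k + 1)) := by
        field_simp
      rw [h4]
      refine le_mul_of_one_le_right h3.le ?_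
      rw [le_div_iff₀ (by positivity)]
      linarith
    linarith

/-- The lower tail of the binomial distribution at half its mean `x`, from above: the tail is
dominated by its last term, which Stirling's formula estimates. -/
lemma exists_binomial_tail_le : ∃ C : ℝ, 0 < C ∧ ∀ (N k : ℕ) (p x : ℝ), 0 ≤ p → p ≤ 1 →
    x = N * p → 8 ≤ x → x ^ 2 ≤ N → x / 2 ≤ k → (k : ℝ) ≤ x / 2 + 2 →
    ∑ j ∈ Finset.range (k + 1), (N.choose j : ℝ) * p ^ j * (1 - p) ^ (N - j) ≤
      C * (Real.exp (-(x / β)) / √x) := by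
  refine ⟨4 * Real.exp 1 * Real.exp (2 * (1 + Real.log 2)) * √2, by positivity, ?_⟩
  intro N k p x hp0 hp1 hx hx8 hxN hk1 hk2
  have hx0 : 0 < x := by linarith
  have hk34 : (k : ℝ) ≤ 3 / 4 * x := by linarith
  have hkN : k ≤ N := by
    have : (k : ℝ) ≤ N := by nlinarith
    exact_mod_cast this
  have hk0 : 1 ≤ k := by
    have : (1 : ℝ) ≤ k := by linarith
    exact_mod_cast this
  have hpk : p * k ≤ 1 := by
    have hN : (0 : ℝ) < N := by nlinarith
    have : (N : ℝ) * (p * k) ≤ N * 1 := by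
      calc (N : ℝ) * (p * k) = x * k := by rw [hx]; ring
        _ ≤ N * 1 := by nlinarith
    exact le_of_mul_le_mul_left this hN
  have h1 : ∑ j ∈ Finset.range (k + 1), (N.choose j : ℝ) * p ^ j * (1 - p) ^ (N - j) ≤
      ∑ j ∈ Finset.range (k + 1), x ^ j / (j.factorial : ℝ) * Real.exp (1 - x) := by
    refine Finset.sum_le_sum fun j hj => ?_
    have hjk : j ≤ k := Nat.lt_succ_iff.1 (Finset.mem_range.1 hj)
    have h2 : (N.choose j : ℝ) * p ^ j ≤ x ^ j / (j.factorial : ℝ) := by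
      rw [hx, mul_pow, mul_div_right_comm]
      exact mul_le_mul_of_nonneg_right (Nat.choose_le_pow_div j N) (by positivity)
    have h3 : (1 - p) ^ (N - j) ≤ Real.exp (1 - x) := by
      calc (1 - p) ^ (N - j) ≤ Real.exp (-p) ^ (N - j) :=
            pow_le_pow_left₀ (by linarith) (Real.one_sub_le_exp_neg p) _
        _ = Real.exp (((N - j : ℕ) : ℝ) * -p) := (Real.exp_nat_mul _ _).symm
        _ ≤ Real.exp (1 - x) := by
          refine Real.exp_le_exp.2 ?_
          rw [Nat.cast_sub (hjk.trans hkN), hx]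
          have : (j : ℝ) ≤ k := by exact_mod_cast hjk
          nlinarith
    exact mul_le_mul h2 h3 (pow_nonneg (by linarith) _) (by positivity)
  rw [← Finset.sum_mul] at h1
  have h4 : x ^ k / (k.factorial : ℝ) ≤
      Real.exp ((x / 2 + 2) * (1 + Real.log 2)) / √(x / 2) := by
    have hk0' : (0 : ℝ) < k := by exact_mod_cast hk0
    have hlog : 0 < Real.log 2 := Real.log_pos one_lt_two
    rw [div_le_div_iff₀ (by positivity) (by positivity), mul_div_pow_eq hk0]
    have h5 : (Real.exp 1 * (x / k)) ^ k ≤ Real.exp ((x / 2 + 2) * (1 + Real.log 2)) := by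
      calc (Real.exp 1 * (x / k)) ^ k ≤ (Real.exp 1 * 2) ^ k := by
            gcongr
            rw [div_le_iff₀ hk0']
            linarith
        _ = Real.exp (k * (1 + Real.log 2)) := two_exp_pow k
        _ ≤ _ := by gcongr
    have h6 : √(x / 2) * (k / Real.exp 1) ^ k ≤ (k.factorial : ℝ) :=
      le_trans (by gcongr) (sqrt_mul_pow_le_factorial k)
    calc _ = (Real.exp 1 * (x / k)) ^ k * (√(x / 2) * (k / Real.exp 1) ^ k) := by ring
      _ ≤ _ := mul_le_mul h5 h6 (by positivity) (by positivity)
  calc _ ≤ _ := h1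
    _ ≤ 4 * (x ^ k / (k.factorial : ℝ)) * Real.exp (1 - x) := by
        gcongr
        exact sum_pow_div_factorial_le hx0 k hk34
    _ ≤ 4 * (Real.exp ((x / 2 + 2) * (1 + Real.log 2)) / √(x / 2)) * Real.exp (1 - x) := by
        gcongr
    _ = _ := by
        have h7 : Real.exp ((x / 2 + 2) * (1 + Real.log 2)) * Real.exp (1 - x) =
            Real.exp 1 * Real.exp (2 * (1 + Real.log 2)) * Real.exp (-(x / β)) := by
          rw [← Real.exp_add, ← Real.exp_add, ← Real.exp_add, div_eq_mul_inv x β, inv_β]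
          congr 1
          ring
        rw [Real.sqrt_div hx0.le, div_div_eq_mul_div]
        linear_combination (4 * √2 / √x) * h7

/-- The probability `(1 - p) ^ N` that a binomial variable of mean `x` vanishes, from below. -/
lemma exp_le_one_sub_pow {N : ℕ} {p x : ℝ} (hp0 : 0 ≤ p) (hp1 : p ≤ 1 / 2) (hx : x = N * p)
    (hxN : x ^ 2 ≤ N) : Real.exp (-x - 2) ≤ (1 - p) ^ N := by
  have h1 : Real.exp (-(p / (1 - p))) ≤ 1 - p := by
    rw [Real.exp_neg, inv_le_comm₀ (Real.exp_pos _) (by linarith)]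
    refine le_trans (le_of_eq ?_) (Real.add_one_le_exp _)
    have : 1 - p ≠ 0 := by linarith
    field_simp
    ring
  refine le_trans ?_ (pow_le_pow_left₀ (Real.exp_pos _).le h1 N)
  rw [← Real.exp_nat_mul]
  refine Real.exp_le_exp.2 ?_
  have h2 : p / (1 - p) ≤ p + 2 * p ^ 2 := by
    rw [div_le_iff₀ (by linarith)]
    nlinarith [mul_nonneg hp0 hp0, mul_nonneg (mul_nonneg hp0 hp0) (by linarith : 0 ≤ 1 / 2 - p)]
  have h3 : (N : ℝ) * p ^ 2 ≤ 1 := by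
    rcases Nat.eq_zero_or_pos N with h | h
    · simp [h]
    · have hN : (0 : ℝ) < N := by exact_mod_cast h
      have : (N : ℝ) * (N * p ^ 2) ≤ N * 1 := by
        calc (N : ℝ) * (N * p ^ 2) = x ^ 2 := by rw [hx]; ring
          _ ≤ _ := by linarith
      exact le_of_mul_le_mul_left this hN
  have h4 : (N : ℝ) * (p / (1 - p)) ≤ N * (p + 2 * p ^ 2) := by gcongr
  rw [hx]
  linarith

/-- The probability that a binomial variable equals about half its mean `x`, from below. -/
lemma exists_le_binomial : ∃ c : ℝ, 0 < c ∧ ∀ (N k : ℕ) (p x : ℝ), 0 ≤ p → p ≤ 1 / 2 →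
    x = N * p → 8 ≤ x → x ^ 2 ≤ N → x / 2 - 2 ≤ k → (k : ℝ) ≤ x / 2 →
    c * (Real.exp (-(x / β)) / √x) ≤ (N.choose k : ℝ) * p ^ k * (1 - p) ^ (N - k) := by
  refine ⟨3 / 4 * Real.exp (-2) * Real.exp (-2 * (1 + Real.log 2)) * Real.exp (-1),
    by positivity, ?_⟩
  intro N k p x hp0 hp1 hx hx8 hxN hk1 hk2
  have hx0 : 0 < x := by linarith
  have hN : (0 : ℝ) < N := by nlinarith
  have hkN : k ≤ N := by
    have : (k : ℝ) ≤ N := by nlinarith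
    exact_mod_cast this
  have hk0' : (1 : ℝ) ≤ k := by linarith
  have hk0 : 1 ≤ k := by exact_mod_cast hk0'
  have hlog : 0 < Real.log 2 := Real.log_pos one_lt_two
  have h1 : 3 / 4 * (x ^ k / (k.factorial : ℝ)) ≤ (N.choose k : ℝ) * p ^ k := by
    have h2 : ((N + 1 - k : ℕ) : ℝ) ^ k ≤ (k.factorial : ℝ) * (N.choose k : ℝ) := by
      have := Nat.pow_le_choose (α := ℝ) k N
      rwa [div_le_iff₀' (by positivity)] at this
    have h3 : 3 / 4 * (N : ℝ) ^ k ≤ ((N + 1 - k : ℕ) : ℝ) ^ k := by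
      have h4 : 3 / 4 ≤ (1 + -((k : ℝ) / N)) ^ k := by
        refine le_trans ?_ (one_add_mul_le_pow ?_ k)
        · have : (k : ℝ) * (k / N) ≤ 1 / 4 := by
            rw [← mul_div_assoc, div_le_iff₀ hN]
            nlinarith
          linarith
        · have : (k : ℝ) / N ≤ 1 := by
            rw [div_le_one hN]
            exact_mod_cast hkN
          linarith
      calc 3 / 4 * (N : ℝ) ^ k ≤ (1 + -((k : ℝ) / N)) ^ k * (N : ℝ) ^ k := by gcongr
        _ = ((N : ℝ) - k) ^ k := by
          rw [← mul_pow]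
          congr 1
          field_simp
          ring
        _ ≤ _ := by
          have : (k : ℝ) ≤ N := by exact_mod_cast hkN
          refine pow_le_pow_left₀ (by linarith) ?_ k
          rw [Nat.cast_sub (by omega)]
          push_cast
          linarith
    rw [← mul_div_assoc, div_le_iff₀ (by positivity), hx, mul_pow]
    have h5 : 0 ≤ p ^ k := by positivity
    have h6 := mul_le_mul_of_nonneg_right (h3.trans h2) h5
    linarith
  have h2 : Real.exp (-x - 2) ≤ (1 - p) ^ (N - k) :=
    (exp_le_one_sub_pow hp0 hp1 hx hxN).trans
      (pow_le_pow_of_le_one (by linarith) (by linarith) (Nat.sub_le _ _))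
  have h3 : Real.exp ((x / 2 - 2) * (1 + Real.log 2)) / (Real.exp 1 * √x) ≤
      x ^ k / (k.factorial : ℝ) := by
    rw [div_le_div_iff₀ (by positivity) (by positivity), mul_div_pow_eq hk0]
    have h5 : Real.exp ((x / 2 - 2) * (1 + Real.log 2)) ≤ (Real.exp 1 * (x / k)) ^ k := by
      calc _ ≤ Real.exp (k * (1 + Real.log 2)) := by gcongr
        _ = (Real.exp 1 * 2) ^ k := (two_exp_pow k).symm
        _ ≤ _ := by
            gcongr
            rw [le_div_iff₀ (by linarith)]
            linarith
    have h6 : (k.factorial : ℝ) ≤ Real.exp 1 * √x * (k / Real.exp 1) ^ k :=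
      (factorial_le_sqrt_mul_pow hk0).trans (by gcongr; linarith)
    calc _ ≤ (Real.exp 1 * (x / k)) ^ k * (Real.exp 1 * √x * (k / Real.exp 1) ^ k) :=
          mul_le_mul h5 h6 (by positivity) (by positivity)
      _ = _ := by ring
  have h4 := mul_le_mul (mul_le_mul_of_nonneg_left h3 (by norm_num : (0 : ℝ) ≤ 3 / 4) |>.trans h1)
    h2 (Real.exp_pos _).le (by positivity)
  refine le_trans (le_of_eq ?_) h4
  have h7 : Real.exp ((x / 2 - 2) * (1 + Real.log 2)) * Real.exp (-x - 2) =
      Real.exp (-2) * Real.exp (-2 * (1 + Real.log 2)) * Real.exp (-(x / β)) := by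
    rw [← Real.exp_add, ← Real.exp_add, ← Real.exp_add, div_eq_mul_inv x β, inv_β]
    congr 1
    ring
  rw [Real.exp_neg 1]
  linear_combination (-(3 / 4) / (Real.exp 1 * √x)) * h7

/-- The exponent in the Chernoff bound for the lower tail: a binomial variable of mean `x` is at most
`t * x` with probability at most `exp (-(chernoffRate t * x))`, for `t ≤ 1`. -/
noncomputable def chernoffRate (t : ℝ) : ℝ := 1 - t + t * Real.log t

lemma chernoffRate_pos {t : ℝ} (h0 : 0 < t) (h1 : t < 1) : 0 < chernoffRate t := by
  have h := Real.log_lt_sub_one_of_pos (inv_pos.2 h0) (by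
    intro h
    rw [inv_eq_one] at h
    linarith)
  rw [Real.log_inv] at h
  have h2 := mul_lt_mul_of_pos_left h h0
  have h3 : t * t⁻¹ = 1 := mul_inv_cancel₀ h0.ne'
  unfold chernoffRate
  linarith

/-- The sum on the left is the probability that a binomial variable of mean `x` is at most `k`; the
bound is the moment bound with the weights `t ^ j`. -/
lemma binomial_tail_le_chernoff {N k : ℕ} {p x t : ℝ} (hp0 : 0 ≤ p) (hp1 : p ≤ 1)
    (hx : x = N * p) (ht0 : 0 < t) (ht1 : t ≤ 1) (hk : (k : ℝ) ≤ t * x) :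
    ∑ j ∈ Finset.range (k + 1), (N.choose j : ℝ) * p ^ j * (1 - p) ^ (N - j) ≤
      Real.exp (-(chernoffRate t * x)) := by
  have hkN : k ≤ N := by
    have : (k : ℝ) ≤ N := by
      have : (0 : ℝ) ≤ N := by positivity
      have h2 : x ≤ N := by rw [hx]; nlinarith
      have h3 : 0 ≤ x := by rw [hx]; positivity
      nlinarith
    exact_mod_cast this
  have h1 : ∑ j ∈ Finset.range (k + 1), (N.choose j : ℝ) * p ^ j * (1 - p) ^ (N - j) ≤
      (t ^ k)⁻¹ * (t * p + (1 - p)) ^ N := by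
    rw [add_pow, Finset.mul_sum]
    calc _ ≤ ∑ j ∈ Finset.range (k + 1),
          (t ^ k)⁻¹ * ((t * p) ^ j * (1 - p) ^ (N - j) * (N.choose j : ℝ)) := by
          refine Finset.sum_le_sum fun j hj => ?_
          have hjk : j ≤ k := Nat.lt_succ_iff.1 (Finset.mem_range.1 hj)
          have h2 : 1 ≤ (t ^ k)⁻¹ * t ^ j := by
            rw [inv_mul_eq_div, one_le_div (by positivity)]
            exact pow_le_pow_of_le_one ht0.le ht1 hjk
          have h3 : 0 ≤ (N.choose j : ℝ) * p ^ j * (1 - p) ^ (N - j) :=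
            mul_nonneg (by positivity) (pow_nonneg (by linarith) _)
          calc _ ≤ ((t ^ k)⁻¹ * t ^ j) * ((N.choose j : ℝ) * p ^ j * (1 - p) ^ (N - j)) :=
                le_mul_of_one_le_left h3 h2
            _ = _ := by rw [mul_pow]; ring
      _ ≤ _ := by
          refine Finset.sum_le_sum_of_subset_of_nonneg
            (Finset.range_subset_range.2 (by omega)) fun j _ _ => ?_
          have : 0 ≤ (1 - p) ^ (N - j) := pow_nonneg (by linarith) _
          positivity
  refine h1.trans ?_
  have h2 : (t ^ k)⁻¹ ≤ Real.exp (-(t * x * Real.log t)) := by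
    rw [← Real.rpow_natCast, ← Real.rpow_neg ht0.le, Real.rpow_def_of_pos ht0]
    refine Real.exp_le_exp.2 ?_
    have := Real.log_nonpos ht0.le ht1
    nlinarith
  have h3 : (t * p + (1 - p)) ^ N ≤ Real.exp (-((1 - t) * x)) := by
    calc _ ≤ Real.exp (-((1 - t) * p)) ^ N := by
          refine pow_le_pow_left₀ (by nlinarith) ?_ N
          have := Real.one_sub_le_exp_neg ((1 - t) * p)
          linarith
      _ = _ := by
          rw [← Real.exp_nat_mul, hx]
          congr 1
          ring
  calc _ ≤ Real.exp (-(t * x * Real.log t)) * Real.exp (-((1 - t) * x)) :=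
        mul_le_mul h2 h3 (pow_nonneg (by nlinarith) _) (Real.exp_pos _).le
    _ = _ := by
        rw [← Real.exp_add, chernoffRate]
        congr 1
        ring

/-! ### Short time intervals -/

/-- The time at which the expected degree of a vertex is `y`, truncated to `[0,1]`. -/
noncomputable def timeOf (n : ℕ) (y : ℝ) : unitInterval :=
  Set.projIcc 0 1 zero_le_one (y / ((n : ℝ) - 1))

lemma natCast_sub_one_pos {n : ℕ} (hn : 2 ≤ n) : 0 < (n : ℝ) - 1 := by
  have : (2 : ℝ) ≤ n := by exact_mod_cast hn
  linarith

lemma timeOf_mul {n : ℕ} (hn : 2 ≤ n) (p : unitInterval) :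
    timeOf n (((n : ℝ) - 1) * p) = p := by
  rw [timeOf, mul_div_cancel_left₀ _ (natCast_sub_one_pos hn).ne']
  exact Set.projIcc_val zero_le_one p

lemma timeOf_mono {n : ℕ} (hn : 2 ≤ n) : Monotone (timeOf n) := fun _ _ h =>
  Set.monotone_projIcc zero_le_one (div_le_div_of_nonneg_right h (natCast_sub_one_pos hn).le)

lemma timeOf_le {n : ℕ} (hn : 2 ≤ n) {y : ℝ} {p : unitInterval}
    (h : y ≤ ((n : ℝ) - 1) * p) : timeOf n y ≤ p :=
  (timeOf_mono hn h).trans_eq (timeOf_mul hn p)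

lemma le_timeOf {n : ℕ} (hn : 2 ≤ n) {y : ℝ} {p : unitInterval}
    (h : ((n : ℝ) - 1) * p ≤ y) : p ≤ timeOf n y :=
  (timeOf_mul hn p).symm.trans_le (timeOf_mono hn h)

lemma mul_timeOf {n : ℕ} (hn : 2 ≤ n) {y : ℝ} (h0 : 0 ≤ y) (h1 : y ≤ n - 1) :
    ((n : ℝ) - 1) * timeOf n y = y := by
  have hN := natCast_sub_one_pos hn
  rw [timeOf, Set.projIcc_of_mem zero_le_one
    (⟨div_nonneg h0 hN.le, (div_le_one hN).2 h1⟩ : y / ((n : ℝ) - 1) ∈ Set.Icc (0 : ℝ) 1)]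
  exact mul_div_cancel₀ _ hN.ne'

lemma mul_timeOf_le {n : ℕ} (hn : 2 ≤ n) {y : ℝ} (h0 : 0 ≤ y) :
    ((n : ℝ) - 1) * timeOf n y ≤ y := by
  have hN := natCast_sub_one_pos hn
  rcases le_total y (n - 1) with h | h
  · exact (mul_timeOf hn h0 h).le
  · have := (timeOf n y).2.2
    nlinarith

lemma law_real_degree_le {n : ℕ} (v : Fin n) (p : unitInterval) (k : ℕ) :
    (law n).real {P | openCount (edgesAt v) p P ≤ k} = ∑ j ∈ Finset.range (k + 1),
      ((n - 1).choose j : ℝ) * (p : ℝ) ^ j * (1 - p) ^ (n - 1 - j) := by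
  rw [law_real_openCount_le, card_edgesAt]

lemma law_real_exists_vertex_le {n : ℕ} (p : unitInterval) (k : ℕ) {b : ℝ}
    (h : ∀ v : Fin n, (law n).real {P | openCount (edgesAt v) p P ≤ k} ≤ b) :
    (law n).real {P | ∃ v : Fin n, openCount (edgesAt v) p P ≤ k} ≤ n * b := by
  have : {P : Labels n | ∃ v : Fin n, openCount (edgesAt v) p P ≤ k} =
      ⋃ v ∈ (Finset.univ : Finset (Fin n)), {P | openCount (edgesAt v) p P ≤ k} := by
    ext P
    simp
  rw [this]
  refine (measureReal_biUnion_finset_le _ _).trans ?_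
  refine (Finset.sum_le_card_nsmul _ _ _ fun v _ => h v).trans (le_of_eq ?_)
  rw [Finset.card_univ, Fintype.card_fin, nsmul_eq_mul]

/-- While the expected degree grows from `y` to `y + 1`, the minimum degree is at least its
initial value and `dBar` is at most its final value. -/
lemma exists_law_real_minDeg_le_half :
    ∃ C : ℝ, 0 < C ∧ ∀ (n : ℕ) (y : ℝ), 2 ≤ n → 8 ≤ y → (y + 1) ^ 2 ≤ n - 1 →
    (law n).real {P | ∃ p : unitInterval, y ≤ ((n : ℝ) - 1) * p ∧ ((n : ℝ) - 1) * p ≤ y + 1 ∧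
        (minDeg (graph P p) : ℝ) ≤ dBar (graph P p) / 2} ≤
      n * (C * (Real.exp (-(y / β)) / √y)) + 16 * ((y + 1) / (n - 1)) := by
  obtain ⟨C, hC, h⟩ := exists_binomial_tail_le
  refine ⟨C, hC, fun n y hn hy hyn => ?_⟩
  have hN := natCast_sub_one_pos hn
  have hcast : ((n - 1 : ℕ) : ℝ) = n - 1 := by
    rw [Nat.cast_sub (by omega)]
    simp
  set p₀ := timeOf n y with hp₀
  set p₁ := timeOf n (y + 1) with hp₁
  have hy0 : ((n : ℝ) - 1) * p₀ = y := mul_timeOf hn (by linarith) (by nlinarith)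
  have hy1 : ((n : ℝ) - 1) * p₁ = y + 1 := mul_timeOf hn (by linarith) (by nlinarith)
  have hp₁' : (p₁ : ℝ) = (y + 1) / (n - 1) := by
    rw [← hy1, mul_div_cancel_left₀ _ hN.ne']
  have hp₁half : (p₁ : ℝ) ≤ 1 / 2 := by
    rw [hp₁', div_le_iff₀ hN]
    nlinarith
  -- `k` exceeds half of `dBar` at the end, which is at most `y + 1 + p₁ + 1 / 2`
  set k := ⌈y / 2⌉₊ + 1 with hk
  have hk1 : y / 2 + 1 ≤ k := by
    rw [hk]
    push_cast
    linarith [Nat.le_ceil (y / 2)]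
  have hk2 : (k : ℝ) ≤ y / 2 + 2 := by
    rw [hk]
    push_cast
    linarith [Nat.ceil_lt_add_one (by linarith : 0 ≤ y / 2)]
  have hsub : {P : Labels n | ∃ p : unitInterval, y ≤ ((n : ℝ) - 1) * p ∧
      ((n : ℝ) - 1) * p ≤ y + 1 ∧ (minDeg (graph P p) : ℝ) ≤ dBar (graph P p) / 2} ⊆
      {P | ∃ v : Fin n, openCount (edgesAt v) p₀ P ≤ k} ∪
        {P | 1 / 2 ≤ |dBar (graph P p₁) - n * p₁|} := by
    rintro P ⟨p, hyp, hpy, hP⟩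
    by_contra hcon
    simp only [Set.mem_union, Set.mem_ofPred_eq, not_or, not_exists, not_le] at hcon
    obtain ⟨hdeg, hd⟩ := hcon
    refine absurd hP (not_le.2 (lt_minDeg_graph (by omega) P p fun v => ?_))
    have h1 : (k : ℝ) < openCount (edgesAt v) p P := by
      exact_mod_cast (hdeg v).trans_le (openCount_mono _ P (timeOf_le hn hyp))
    have h2 := dBar_mono (by omega : 1 ≤ n) P (le_timeOf hn hpy)
    have h3 := (abs_lt.1 hd).2
    have h4 : (n : ℝ) * p₁ = y + 1 + p₁ := by linarith
    linarith
  refine (measureReal_mono hsub).trans ((measureReal_union_le _ _).trans (add_le_add ?_ ?_))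
  · refine law_real_exists_vertex_le p₀ k fun v => ?_
    rw [law_real_degree_le]
    refine h (n - 1) k p₀ y p₀.2.1 p₀.2.2 (by rw [hcast, hy0]) hy ?_ (by linarith) hk2
    rw [hcast]
    nlinarith
  · refine (law_real_dBar_deviation hn p₁ (by norm_num : (0 : ℝ) < 1 / 2)).trans (le_of_eq ?_)
    rw [hp₁']
    ring

/-- While the expected degree grows from `y` to `y + 1`, a vertex whose final degree is at most half
the initial value of `dBar` has at most half the average degree all the time. -/
lemma exists_law_real_half_lt_minDeg :
    ∃ C : ℝ, 0 < C ∧ ∀ (n : ℕ) (y : ℝ), 2 ≤ n → 8 ≤ y → (y + 1) ^ 2 ≤ n - 1 →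
    (law n).real {P | ∃ p : unitInterval, y ≤ ((n : ℝ) - 1) * p ∧ ((n : ℝ) - 1) * p ≤ y + 1 ∧
        dBar (graph P p) / 2 < (minDeg (graph P p) : ℝ)} ≤
      C * (√(y + 1) * Real.exp ((y + 1) / β) / n) + 10 * ((y + 1) / (n - 1)) := by
  obtain ⟨c, hc, h⟩ := exists_le_binomial
  refine ⟨1 / c, by positivity, fun n y hn hy hyn => ?_⟩
  have hN := natCast_sub_one_pos hn
  have hn0 : (0 : ℝ) < n := by linarith
  have hcast : ((n - 1 : ℕ) : ℝ) = n - 1 := by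
    rw [Nat.cast_sub (by omega)]
    simp
  set p₀ := timeOf n y with hp₀
  set p₁ := timeOf n (y + 1) with hp₁
  have hy0 : ((n : ℝ) - 1) * p₀ = y := mul_timeOf hn (by linarith) (by nlinarith)
  have hy1 : ((n : ℝ) - 1) * p₁ = y + 1 := mul_timeOf hn (by linarith) (by nlinarith)
  have hp₀' : (p₀ : ℝ) = y / (n - 1) := by
    rw [eq_div_iff hN.ne', mul_comm, hy0]
  have hp₁' : (p₁ : ℝ) = (y + 1) / (n - 1) := by
    rw [← hy1, mul_div_cancel_left₀ _ hN.ne']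
  have hp₁quarter : (p₁ : ℝ) ≤ 1 / 4 := by
    rw [hp₁', div_le_iff₀ hN]
    nlinarith
  -- `k` is at most half of `dBar` at the start, which is at least `y - 1`
  set k := ⌊(y - 1) / 2⌋₊ with hk
  have hk1 : (k : ℝ) ≤ (y - 1) / 2 := Nat.floor_le (by linarith)
  have hk2 : (y - 1) / 2 - 1 ≤ k := by linarith [Nat.lt_floor_add_one ((y - 1) / 2)]
  have hsub : {P : Labels n | ∃ p : unitInterval, y ≤ ((n : ℝ) - 1) * p ∧
      ((n : ℝ) - 1) * p ≤ y + 1 ∧ dBar (graph P p) / 2 < (minDeg (graph P p) : ℝ)} ⊆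
      {P | ∀ v : Fin n, k < openCount (edgesAt v) p₁ P} ∪
        {P | 1 ≤ |dBar (graph P p₀) - n * p₀|} := by
    rintro P ⟨p, hyp, hpy, hP⟩
    by_contra hcon
    simp only [Set.mem_union, Set.mem_ofPred_eq, not_or, not_forall, not_lt, not_le] at hcon
    obtain ⟨⟨v, hv⟩, hd⟩ := hcon
    refine absurd hP (not_lt.2 ?_)
    have h1 : (minDeg (graph P p) : ℝ) ≤ k := by
      exact_mod_cast (minDeg_graph_le P p v).trans
        ((openCount_mono _ P (le_timeOf hn hpy)).trans hv)
    have h2 := dBar_mono (by omega : 1 ≤ n) P (timeOf_le hn hyp)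
    have h3 := (abs_lt.1 hd).1
    have h4 : (n : ℝ) * p₀ = y + p₀ := by linarith
    have h5 := p₀.2.1
    linarith
  have ha : ∀ v : Fin n, c * (Real.exp (-((y + 1) / β)) / √(y + 1)) ≤
      (law n).real {P | openCount (edgesAt v) p₁ P ≤ k} := by
    intro v
    rw [law_real_degree_le]
    refine (h (n - 1) k p₁ (y + 1) p₁.2.1 (by linarith) (by rw [hcast, hy1]) (by linarith)
      (by rwa [hcast]) (by linarith) (by linarith)).trans ?_
    refine Finset.single_le_sum (f := fun j => ((n - 1).choose j : ℝ) * (p₁ : ℝ) ^ j *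
      (1 - p₁) ^ (n - 1 - j)) (fun j _ => ?_) (Finset.self_mem_range_succ k)
    have h6 := p₁.2.1
    have h7 : 0 ≤ (1 - (p₁ : ℝ)) ^ (n - 1 - j) := pow_nonneg (by linarith) _
    positivity
  refine (measureReal_mono hsub).trans ((measureReal_union_le _ _).trans ?_)
  have h8 := law_real_forall_lt_openCount_le (by omega : 1 ≤ n) p₁ hp₁quarter k
    (by positivity) ha
  have h9 := law_real_dBar_deviation hn p₀ one_pos
  have h10 : 1 / (n * (c * (Real.exp (-((y + 1) / β)) / √(y + 1)))) =
      1 / c * (√(y + 1) * Real.exp ((y + 1) / β) / n) := by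
    rw [Real.exp_neg]
    field_simp
  have h11 : (p₀ : ℝ) ≤ p₁ := timeOf_mono hn (by linarith)
  rw [h10] at h8
  rw [← hp₁']
  linarith

/-- By the second moment method there is an isolated vertex when the expected degree is `y`, and it is
isolated at all earlier times. -/
lemma law_real_half_lt_minDeg_start {n : ℕ} (hn : 2 ≤ n) {y : ℝ} (hy : 4 ≤ y)
    (hyn : y ^ 2 ≤ n - 1) :
    (law n).real {P | ∃ p : unitInterval, ((n : ℝ) - 1) * p ≤ y ∧
        dBar (graph P p) / 2 < (minDeg (graph P p) : ℝ)} ≤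
      Real.exp (y + 2) / n + 6 * (y / (n - 1)) := by
  have hN := natCast_sub_one_pos hn
  have hcast : ((n - 1 : ℕ) : ℝ) = n - 1 := by
    rw [Nat.cast_sub (by omega)]
    simp
  set p₁ := timeOf n y with hp₁
  have hy1 : ((n : ℝ) - 1) * p₁ = y := mul_timeOf hn (by linarith) (by nlinarith)
  have hp₁' : (p₁ : ℝ) = y / (n - 1) := by
    rw [eq_div_iff hN.ne', mul_comm, hy1]
  have hp₁quarter : (p₁ : ℝ) ≤ 1 / 4 := by
    rw [hp₁', div_le_iff₀ hN]
    nlinarith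
  have ha : ∀ v : Fin n, Real.exp (-y - 2) ≤
      (law n).real {P | openCount (edgesAt v) p₁ P ≤ 0} := by
    intro v
    rw [law_real_degree_le]
    simpa using exp_le_one_sub_pow (N := n - 1) p₁.2.1 (by linarith) (by rw [hcast, hy1])
      (by rwa [hcast])
  have h8 := law_real_forall_lt_openCount_le (by omega : 1 ≤ n) p₁ hp₁quarter 0
    (Real.exp_pos _) ha
  refine (measureReal_mono fun P hP => ?_).trans (h8.trans (le_of_eq ?_))
  · obtain ⟨p, hpy, hP⟩ := hP
    by_contra hcon
    simp only [Set.mem_ofPred_eq, not_forall, not_lt] at hcon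
    obtain ⟨v, hv⟩ := hcon
    have h1 : (minDeg (graph P p) : ℝ) ≤ (0 : ℕ) := by
      exact_mod_cast (minDeg_graph_le P p v).trans
        ((openCount_mono _ P (le_timeOf hn hpy)).trans hv)
    have h2 := dBar_nonneg (by omega : 1 ≤ n) P p
    push_cast at h1
    linarith
  · rw [hp₁', (by ring : -y - 2 = -(y + 2)), Real.exp_neg]
    field_simp

/-- For `θ < 1` a deviation of the degrees below `(1 + θ) / 2` times their mean is needed, whose
probability decays exponentially in the mean. -/
lemma law_real_minDeg_le_mul {θ : ℝ} (h0 : 0 < θ) (h1 : θ < 1) {n : ℕ} (hn : 2 ≤ n) {y : ℝ}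
    (hy : 12 / (1 - θ) ≤ y) (hyn : y ≤ n - 1) :
    (law n).real {P | ∃ p : unitInterval, y ≤ ((n : ℝ) - 1) * p ∧ ((n : ℝ) - 1) * p ≤ y + 1 ∧
        (minDeg (graph P p) : ℝ) ≤ θ * dBar (graph P p)} ≤
      n * Real.exp (-(chernoffRate ((1 + θ) / 2) * y)) +
        128 / ((1 - θ) ^ 2 * y * (n - 1)) := by
  have hN := natCast_sub_one_pos hn
  have hθ : 0 < 1 - θ := by linarith
  have hy12 : 12 ≤ (1 - θ) * y := by
    rwa [div_le_iff₀' hθ] at hy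
  have hypos : 0 < y := by
    by_contra hcon
    nlinarith
  have hcast : ((n - 1 : ℕ) : ℝ) = n - 1 := by
    rw [Nat.cast_sub (by omega)]
    simp
  set t := (1 + θ) / 2 with ht
  set p₀ := timeOf n y with hp₀
  set p₁ := timeOf n (y + 1) with hp₁
  have hy0 : ((n : ℝ) - 1) * p₀ = y := mul_timeOf hn hypos.le hyn
  have hy1 : ((n : ℝ) - 1) * p₁ ≤ y + 1 := mul_timeOf_le hn (by linarith)
  set k := ⌊t * y⌋₊ with hk
  have hty : 0 ≤ t * y := by positivity
  have hk1 : (k : ℝ) ≤ t * y := Nat.floor_le hty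
  set s := (1 - θ) / 4 * y with hs
  have hspos : 0 < s := by positivity
  have hsub : {P : Labels n | ∃ p : unitInterval, y ≤ ((n : ℝ) - 1) * p ∧
      ((n : ℝ) - 1) * p ≤ y + 1 ∧ (minDeg (graph P p) : ℝ) ≤ θ * dBar (graph P p)} ⊆
      {P | ∃ v : Fin n, openCount (edgesAt v) p₀ P ≤ k} ∪
        {P | s ≤ |dBar (graph P p₁) - n * p₁|} := by
    rintro P ⟨p, hyp, hpy, hP⟩
    by_contra hcon
    simp only [Set.mem_union, Set.mem_ofPred_eq, not_or, not_exists, not_le] at hcon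
    obtain ⟨hdeg, hd⟩ := hcon
    refine absurd hP (not_le.2 (lt_minDeg_graph (by omega) P p fun v => ?_))
    have h3 : t * y < openCount (edgesAt v) p P :=
      (Nat.floor_lt hty).1 ((hdeg v).trans_le (openCount_mono _ P (timeOf_le hn hyp)))
    have h4 := dBar_mono (by omega : 1 ≤ n) P (le_timeOf hn hpy)
    have h5 := (abs_lt.1 hd).2
    have h6 : (n : ℝ) * p₁ = (n - 1) * p₁ + p₁ := by ring
    have h7 := p₁.2.2
    have h8 : dBar (graph P p) ≤ y + 2 + s := by linarith
    have h9 : θ * dBar (graph P p) ≤ θ * (y + 2 + s) := by gcongr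
    nlinarith
  refine (measureReal_mono hsub).trans ((measureReal_union_le _ _).trans (add_le_add ?_ ?_))
  · refine law_real_exists_vertex_le p₀ k fun v => ?_
    rw [law_real_degree_le]
    exact binomial_tail_le_chernoff p₀.2.1 p₀.2.2 (by rw [hcast, hy0]) (by positivity)
      (by rw [ht]; linarith) hk1
  · refine (law_real_dBar_deviation hn p₁ hspos).trans ?_
    have h3 : (p₁ : ℝ) ≤ 2 * y / (n - 1) := by
      rw [le_div_iff₀ hN]
      nlinarith
    calc 4 * (p₁ : ℝ) / s ^ 2 ≤ 4 * (2 * y / (n - 1)) / s ^ 2 := by gcongr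
      _ = _ := by
        rw [hs]
        field_simp
        ring

/-- A union bound over the intervals `[a + i, a + i + 1]` that meet `[a, b]`. -/
lemma law_real_exists_time_le {n : ℕ} (Q : SimpleGraph (Fin n) → Prop) {a b : ℝ} (hab : a ≤ b)
    (f : ℝ → ℝ) (hf : ∀ y, a ≤ y → y ≤ b →
      (law n).real {P | ∃ p : unitInterval, y ≤ ((n : ℝ) - 1) * p ∧ ((n : ℝ) - 1) * p ≤ y + 1 ∧
        Q (graph P p)} ≤ f y) :
    (law n).real {P | ∃ p : unitInterval, a ≤ ((n : ℝ) - 1) * p ∧ ((n : ℝ) - 1) * p ≤ b ∧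
        Q (graph P p)} ≤ ∑ i ∈ Finset.range (⌊b - a⌋₊ + 1), f (a + i) := by
  have hsub : {P : Labels n | ∃ p : unitInterval, a ≤ ((n : ℝ) - 1) * p ∧
      ((n : ℝ) - 1) * p ≤ b ∧ Q (graph P p)} ⊆ ⋃ i ∈ Finset.range (⌊b - a⌋₊ + 1),
      {P | ∃ p : unitInterval, a + i ≤ ((n : ℝ) - 1) * p ∧ ((n : ℝ) - 1) * p ≤ a + i + 1 ∧
        Q (graph P p)} := by
    rintro P ⟨p, hap, hpb, hP⟩
    simp only [Set.mem_iUnion, exists_prop, Finset.mem_range, Nat.lt_succ_iff]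
    refine ⟨⌊((n : ℝ) - 1) * p - a⌋₊, Nat.floor_le_floor (by linarith), p, ?_, ?_, hP⟩
    · linarith [Nat.floor_le (by linarith : 0 ≤ ((n : ℝ) - 1) * p - a)]
    · linarith [Nat.lt_floor_add_one (((n : ℝ) - 1) * p - a)]
  refine (measureReal_mono hsub (measure_ne_top _ _)).trans
    ((measureReal_biUnion_finset_le _ _).trans ?_)
  refine Finset.sum_le_sum fun i hi => hf _ (by simp) ?_
  have h1 : (i : ℝ) ≤ ⌊b - a⌋₊ := by exact_mod_cast Nat.lt_succ_iff.1 (Finset.mem_range.1 hi)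
  linarith [Nat.floor_le (by linarith : 0 ≤ b - a)]

/-! ### The threshold -/

/-- The expected degree `β (log n - log log n / 2)` at which vertices of at most half the average
degree disappear. -/
noncomputable def critDegree (n : ℕ) : ℝ := β * (Real.log n - Real.log (Real.log n) / 2)

lemma exp_critDegree_div {n : ℕ} (hn : 2 ≤ n) :
    Real.exp (critDegree n / β) = n / √(Real.log n) := by
  have h1 : (1 : ℝ) < n := by exact_mod_cast hn
  have h2 : 0 < Real.log n := Real.log_pos h1
  rw [critDegree, mul_div_cancel_left₀ _ β_pos.ne', Real.exp_sub, Real.exp_log (by linarith),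
    Real.sqrt_eq_rpow, Real.rpow_def_of_pos h2, mul_one_div]

lemma log_le_critDegree {n : ℕ} (hn : 1 ≤ Real.log n) : Real.log n ≤ critDegree n := by
  have h1 : Real.log (Real.log n) ≤ Real.log n := Real.log_le_self (by linarith)
  have h2 := two_lt_β
  rw [critDegree]
  nlinarith

lemma critDegree_le {n : ℕ} (hn : 1 ≤ Real.log n) : critDegree n ≤ 7 * Real.log n := by
  have h1 : 0 ≤ Real.log (Real.log n) := Real.log_nonneg hn
  have h2 := β_lt_seven
  have h3 := β_pos
  rw [critDegree]
  nlinarith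

lemma tendsto_log_natCast : Tendsto (fun n : ℕ => Real.log n) atTop atTop :=
  Real.tendsto_log_atTop.comp tendsto_natCast_atTop_atTop

lemma tendsto_sq_log_div (c d : ℝ) :
    Tendsto (fun n : ℕ => (c * Real.log n + d) ^ 2 / ((n : ℝ) - 1)) atTop (𝓝 0) := by
  have h : ∀ k : ℕ, Tendsto (fun n : ℕ => Real.log n ^ k / ((n : ℝ) - 1)) atTop (𝓝 0) := by
    intro k
    have := (Real.tendsto_pow_log_div_mul_add_atTop 1 (-1) k one_ne_zero).comp
      tendsto_natCast_atTop_atTop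
    refine this.congr fun n => ?_
    simp [sub_eq_add_neg]
  have h2 := (((h 2).const_mul (c ^ 2)).add ((h 1).const_mul (2 * c * d))).add
    ((h 0).const_mul (d ^ 2))
  simp only [mul_zero, add_zero] at h2
  refine h2.congr fun n => ?_
  ring

lemma eventually_sq_log_le (c d : ℝ) :
    ∀ᶠ n : ℕ in atTop, (c * Real.log n + d) ^ 2 ≤ (n : ℝ) - 1 := by
  filter_upwards [(tendsto_sq_log_div c d).eventually (gt_mem_nhds one_pos),
    eventually_ge_atTop 2] with n hn hn2
  exact ((div_lt_one (natCast_sub_one_pos hn2)).1 hn).le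

lemma tendsto_exp_neg_div_β {ω : ℕ → ℝ} (hω : Tendsto ω atTop atTop) :
    Tendsto (fun n => Real.exp (-(ω n / β))) atTop (𝓝 0) :=
  Real.tendsto_exp_neg_atTop_nhds_zero.comp (hω.atTop_div_const β_pos)

/-- From a constant multiple of `log n` onwards, all degrees exceed `θ` times `dBar`. -/
lemma exists_tendsto_late {θ : ℝ} (h0 : 0 < θ) (h1 : θ < 1) : ∃ ρ : ℝ, 0 < ρ ∧
    Tendsto (fun n => (law n).real {P | ∃ p : unitInterval,
      ρ * Real.log n ≤ ((n : ℝ) - 1) * p ∧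
        (minDeg (graph P p) : ℝ) ≤ θ * dBar (graph P p)}) atTop (𝓝 0) := by
  set c := chernoffRate ((1 + θ) / 2) with hc
  have hcpos : 0 < c := chernoffRate_pos (by linarith) (by linarith)
  have hρ : 0 < 3 / c := by positivity
  have hθ : 0 < 1 - θ := by linarith
  refine ⟨3 / c, hρ, ?_⟩
  set a : ℕ → ℝ := fun n => 3 / c * Real.log n with ha
  have hat : Tendsto a atTop atTop := tendsto_log_natCast.const_mul_atTop hρ
  have hlim : Tendsto (fun n : ℕ => 1 / (n : ℝ) + 256 / (1 - θ) ^ 2 * (a n)⁻¹) atTop (𝓝 0) := by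
    have := tendsto_one_div_atTop_nhds_zero_nat (𝕜 := ℝ) |>.add
      ((tendsto_inv_atTop_zero.comp hat).const_mul (256 / (1 - θ) ^ 2))
    simpa using this
  refine squeeze_zero' (Eventually.of_forall fun n => measureReal_nonneg) ?_ hlim
  filter_upwards [hat.eventually_ge_atTop (12 / (1 - θ)), eventually_sq_log_le (3 / c) 0,
    eventually_ge_atTop 2, hat.eventually_ge_atTop 1] with n hn12 hnsq hn ha1
  have hN := natCast_sub_one_pos hn
  have hn0 : (0 : ℝ) < n := by linarith
  have hn2 : (2 : ℝ) ≤ n := by exact_mod_cast hn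
  have hab : a n ≤ n - 1 := by
    rw [add_zero] at hnsq
    change a n ^ 2 ≤ _ at hnsq
    nlinarith
  have h2 := law_real_exists_time_le (n := n)
    (fun G => (minDeg G : ℝ) ≤ θ * dBar G) hab
    (fun _ => n * Real.exp (-(c * a n)) + 128 / ((1 - θ) ^ 2 * a n * (n - 1)))
    (fun y hy1 hy2 => (law_real_minDeg_le_mul h0 h1 hn (hn12.trans hy1) hy2).trans (by
      rw [← hc]
      gcongr))
  rw [Finset.sum_const, Finset.card_range, nsmul_eq_mul] at h2
  refine (measureReal_mono ?_ (measure_ne_top _ _)).trans (h2.trans ?_)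
  · rintro P ⟨p, hp, hP⟩
    have := p.2.2
    exact ⟨p, hp, by nlinarith, hP⟩
  · have h3 : ((⌊(n : ℝ) - 1 - a n⌋₊ + 1 : ℕ) : ℝ) ≤ n := by
      push_cast
      linarith [Nat.floor_le (by linarith : 0 ≤ (n : ℝ) - 1 - a n)]
    have h4 : Real.exp (-(c * a n)) = 1 / (n : ℝ) ^ 3 := by
      have : c * a n = (3 : ℕ) * Real.log n := by
        rw [ha]
        field_simp
        push_cast
        ring
      rw [this, Real.exp_neg, Real.exp_nat_mul, Real.exp_log hn0, one_div]
    rw [h4]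
    calc _ ≤ (n : ℝ) * (n * (1 / (n : ℝ) ^ 3) + 128 / ((1 - θ) ^ 2 * a n * (n - 1))) := by
          gcongr
      _ = 1 / n + (n / (n - 1)) * (128 / (1 - θ) ^ 2 * (a n)⁻¹) := by
          have : (n : ℝ) - 1 ≠ 0 := hN.ne'
          field_simp
      _ ≤ 1 / n + 2 * (128 / (1 - θ) ^ 2 * (a n)⁻¹) := by
          gcongr
          rw [div_le_iff₀ hN]
          linarith
      _ = _ := by ring

/-- The expected number of vertices of at most half the average degree decays geometrically
beyond the critical time. -/
lemma tendsto_above_critDegree {ω : ℕ → ℝ} (hω : Tendsto ω atTop atTop) {ρ : ℝ} (hρ : 0 < ρ) :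
    Tendsto (fun n => (law n).real {P | ∃ p : unitInterval,
      critDegree n + ω n ≤ ((n : ℝ) - 1) * p ∧ ((n : ℝ) - 1) * p ≤ ρ * Real.log n ∧
        (minDeg (graph P p) : ℝ) ≤ dBar (graph P p) / 2}) atTop (𝓝 0) := by
  obtain ⟨C, hC, hstep⟩ := exists_law_real_minDeg_le_half
  set r := Real.exp (-β⁻¹) with hr
  have hr1 : r < 1 := by
    rw [hr, ← Real.exp_zero, Real.exp_lt_exp]
    simpa using β_pos
  have hlim : Tendsto (fun n : ℕ => C / (1 - r) * Real.exp (-(ω n / β)) +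
      16 * ((ρ * Real.log n + 1) ^ 2 / ((n : ℝ) - 1))) atTop (𝓝 0) := by
    simpa using ((tendsto_exp_neg_div_β hω).const_mul (C / (1 - r))).add
      ((tendsto_sq_log_div ρ 1).const_mul 16)
  refine squeeze_zero' (Eventually.of_forall fun n => measureReal_nonneg) ?_ hlim
  filter_upwards [hω.eventually_ge_atTop 0, tendsto_log_natCast.eventually_ge_atTop 8,
    eventually_sq_log_le ρ 1, eventually_ge_atTop 2] with n hω0 hlog hsq hn
  have hN := natCast_sub_one_pos hn
  have hn0 : (0 : ℝ) < n := by linarith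
  have hlog0 : 0 < Real.log n := by linarith
  have hr1' : 0 < 1 - r := by linarith
  set a := critDegree n + ω n with ha
  set b := ρ * Real.log n with hb
  have hloga : Real.log n ≤ a := by
    have := log_le_critDegree (n := n) (by linarith)
    linarith
  have hb0 : 0 < b := by positivity
  rcases lt_or_ge b a with hba | hab
  · have : {P : Labels n | ∃ p : unitInterval, a ≤ ((n : ℝ) - 1) * p ∧ ((n : ℝ) - 1) * p ≤ b ∧
        (minDeg (graph P p) : ℝ) ≤ dBar (graph P p) / 2} = ∅ := by
      ext P
      simp only [Set.mem_ofPred_eq, Set.mem_empty_iff_false, iff_false]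
      rintro ⟨p, h1, h2, -⟩
      linarith
    rw [this, measureReal_empty]
    positivity
  have h2 := law_real_exists_time_le (n := n) (fun G => (minDeg G : ℝ) ≤ dBar G / 2) hab
    (fun y => n * (C * (Real.exp (-(y / β)) / √(Real.log n))) + 16 * ((b + 1) / (n - 1)))
    (fun y hy1 hy2 => (hstep n y hn (by linarith) (by nlinarith)).trans (by
      have : Real.log n ≤ y := hloga.trans hy1
      gcongr))
  refine h2.trans ?_
  rw [Finset.sum_add_distrib, Finset.sum_const, Finset.card_range, nsmul_eq_mul]
  refine add_le_add ?_ ?_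
  · have h3 : ∀ i : ℕ, n * (C * (Real.exp (-((a + i) / β)) / √(Real.log n))) =
        C * Real.exp (-(ω n / β)) * r ^ i := by
      intro i
      have h4 : Real.exp (-((a + i) / β)) =
          (Real.exp (critDegree n / β))⁻¹ * Real.exp (-(ω n / β)) * r ^ i := by
        rw [hr, ← Real.exp_nat_mul, ← Real.exp_neg, ← Real.exp_add, ← Real.exp_add, ha]
        congr 1
        rw [div_eq_mul_inv, div_eq_mul_inv, div_eq_mul_inv]
        ring
      rw [h4, exp_critDegree_div hn]
      have : √(Real.log n) ≠ 0 := by positivity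
      field_simp
    simp_rw [h3]
    rw [← Finset.mul_sum]
    have h5 := (summable_geometric_of_lt_one (Real.exp_pos _).le hr1).sum_le_tsum
      (Finset.range (⌊b - a⌋₊ + 1)) (fun i _ => by positivity)
    rw [tsum_geometric_of_lt_one (Real.exp_pos _).le hr1] at h5
    calc _ ≤ C * Real.exp (-(ω n / β)) * (1 - r)⁻¹ := by gcongr
      _ = _ := by ring
  · have h6 : ((⌊b - a⌋₊ + 1 : ℕ) : ℝ) ≤ b + 1 := by
      push_cast
      linarith [Nat.floor_le (by linarith : 0 ≤ b - a)]
    calc _ ≤ (b + 1) * (16 * ((b + 1) / (n - 1))) := by gcongr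
      _ = _ := by ring

/-- Up to the critical time some vertex has at most half the average degree: as long as the
expected degree is below `log n / 2` there is an isolated vertex, and later the second
moment method applies on each interval, with error probabilities that grow geometrically
towards the critical time. -/
lemma tendsto_below_critDegree {ω : ℕ → ℝ} (hω : Tendsto ω atTop atTop) :
    Tendsto (fun n => (law n).real {P | ∃ p : unitInterval,
      ((n : ℝ) - 1) * p ≤ critDegree n - ω n ∧
        dBar (graph P p) / 2 < (minDeg (graph P p) : ℝ)}) atTop (𝓝 0) := by
  obtain ⟨C, hC, hstep⟩ := exists_law_real_half_lt_minDeg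
  set q := Real.exp β⁻¹ with hq
  have hq1 : 1 < q := Real.one_lt_exp_iff.2 (inv_pos.2 β_pos)
  set K := C * √8 * Real.exp (2 / β) / (q - 1) with hK
  have hlim : Tendsto (fun n : ℕ => Real.exp 2 * Real.exp (-(Real.log n / 2)) +
      6 * ((1 * Real.log n + 0) ^ 2 / ((n : ℝ) - 1)) +
      (K * Real.exp (-(ω n / β)) + 10 * ((8 * Real.log n + 0) ^ 2 / ((n : ℝ) - 1))))
      atTop (𝓝 0) := by
    have h1 := Real.tendsto_exp_neg_atTop_nhds_zero.comp
      (tendsto_log_natCast.atTop_div_const two_pos)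
    have h2 := ((h1.const_mul (Real.exp 2)).add ((tendsto_sq_log_div 1 0).const_mul 6)).add
      (((tendsto_exp_neg_div_β hω).const_mul K).add ((tendsto_sq_log_div 8 0).const_mul 10))
    simp only [mul_zero, add_zero] at h2
    simpa using h2
  refine squeeze_zero' (Eventually.of_forall fun n => measureReal_nonneg) ?_ hlim
  filter_upwards [hω.eventually_ge_atTop 0, tendsto_log_natCast.eventually_ge_atTop 16,
    eventually_sq_log_le 8 0, eventually_ge_atTop 2] with n hω0 hlog hsq hn
  have hN := natCast_sub_one_pos hn
  have hn0 : (0 : ℝ) < n := by linarith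
  have hlog0 : 0 < Real.log n := by linarith
  have hq1' : 0 < q - 1 := by linarith
  simp only [add_zero] at hsq ⊢
  set a := Real.log n / 2 with ha
  set b := critDegree n - ω n with hb
  have hb7 : b ≤ 7 * Real.log n := by
    have := critDegree_le (n := n) (by linarith)
    linarith
  have hsub : {P : Labels n | ∃ p : unitInterval, ((n : ℝ) - 1) * p ≤ b ∧
      dBar (graph P p) / 2 < (minDeg (graph P p) : ℝ)} ⊆
      {P | ∃ p : unitInterval, ((n : ℝ) - 1) * p ≤ a ∧
        dBar (graph P p) / 2 < (minDeg (graph P p) : ℝ)} ∪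
      {P | ∃ p : unitInterval, a ≤ ((n : ℝ) - 1) * p ∧ ((n : ℝ) - 1) * p ≤ b ∧
        dBar (graph P p) / 2 < (minDeg (graph P p) : ℝ)} := by
    rintro P ⟨p, hp, hP⟩
    rcases le_total (((n : ℝ) - 1) * p) a with h | h
    · exact Or.inl ⟨p, h, hP⟩
    · exact Or.inr ⟨p, h, hp, hP⟩
  refine (measureReal_mono hsub (measure_ne_top _ _)).trans
    ((measureReal_union_le _ _).trans (add_le_add ?_ ?_))
  · refine (law_real_half_lt_minDeg_start hn (by linarith) (by nlinarith)).trans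
      (add_le_add (le_of_eq ?_) ?_)
    · have h1 : Real.exp (a + 2) = n * (Real.exp 2 * Real.exp (-a)) := by
        rw [← Real.exp_add]
        conv_rhs => rw [← Real.exp_log hn0]
        rw [← Real.exp_add]
        congr 1
        rw [ha]
        ring
      rw [h1, mul_div_cancel_left₀ _ hn0.ne']
    · gcongr
      nlinarith
  rcases lt_or_ge b a with hba | hab
  · have : {P : Labels n | ∃ p : unitInterval, a ≤ ((n : ℝ) - 1) * p ∧ ((n : ℝ) - 1) * p ≤ b ∧
        dBar (graph P p) / 2 < (minDeg (graph P p) : ℝ)} = ∅ := by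
      ext P
      simp only [Set.mem_ofPred_eq, Set.mem_empty_iff_false, iff_false]
      rintro ⟨p, h1, h2, -⟩
      linarith
    rw [this, measureReal_empty]
    positivity
  have h2 := law_real_exists_time_le (n := n) (fun G => dBar G / 2 < (minDeg G : ℝ)) hab
    (fun y => C * (√(8 * Real.log n) * Real.exp ((y + 1) / β) / n) +
      10 * (8 * Real.log n / (n - 1)))
    (fun y hy1 hy2 => (hstep n y hn (by linarith) (by nlinarith)).trans (by
      have : y + 1 ≤ 8 * Real.log n := by linarith
      gcongr))
  refine h2.trans ?_
  rw [Finset.sum_add_distrib, Finset.sum_const, Finset.card_range, nsmul_eq_mul]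
  set L := ⌊b - a⌋₊ + 1 with hL
  have hLle : (L : ℝ) ≤ b - a + 1 := by
    rw [hL]
    push_cast
    linarith [Nat.floor_le (by linarith : 0 ≤ b - a)]
  refine add_le_add ?_ ?_
  · have h3 : ∀ i : ℕ, C * (√(8 * Real.log n) * Real.exp ((a + i + 1) / β) / n) =
        C * (√(8 * Real.log n) * Real.exp ((a + 1) / β) / n) * q ^ i := by
      intro i
      have h4 : Real.exp ((a + i + 1) / β) = Real.exp ((a + 1) / β) * q ^ i := by
        rw [hq, ← Real.exp_nat_mul, ← Real.exp_add]
        congr 1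
        rw [div_eq_mul_inv, div_eq_mul_inv]
        ring
      rw [h4]
      ring
    simp_rw [h3]
    rw [← Finset.mul_sum, geom_sum_eq hq1.ne']
    have h5 : Real.exp ((a + 1) / β) * q ^ L ≤
        Real.exp (2 / β) * (n / √(Real.log n)) * Real.exp (-(ω n / β)) := by
      rw [← exp_critDegree_div hn, hq, ← Real.exp_nat_mul, ← Real.exp_add, ← Real.exp_add,
        ← Real.exp_add]
      refine Real.exp_le_exp.2 ?_
      have h6 : (L : ℝ) * β⁻¹ ≤ (b - a + 1) * β⁻¹ :=
        mul_le_mul_of_nonneg_right hLle (inv_pos.2 β_pos).le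
      simp only [div_eq_mul_inv]
      rw [hb] at h6
      linarith
    calc _ ≤ C * (√(8 * Real.log n) * Real.exp ((a + 1) / β) / n) * (q ^ L / (q - 1)) := by
          gcongr
          linarith
      _ = C * √8 / (q - 1) * (√(Real.log n) / n) * (Real.exp ((a + 1) / β) * q ^ L) := by
          rw [Real.sqrt_mul (by norm_num)]
          ring
      _ ≤ C * √8 / (q - 1) * (√(Real.log n) / n) *
          (Real.exp (2 / β) * (n / √(Real.log n)) * Real.exp (-(ω n / β))) := by
          gcongr
      _ = _ := by
          have : √(Real.log n) ≠ 0 := by positivity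
          rw [hK]
          field_simp
  · calc _ ≤ (8 * Real.log n) * (10 * (8 * Real.log n / (n - 1))) := by
          gcongr
          linarith
      _ = _ := by ring

/-! ### The theorem -/

lemma aas_of_compl_le {H : ∀ n, Set (Labels n)} (hm : ∀ n, MeasurableSet (H n)) {f : ℕ → ℝ}
    (hf : Tendsto f atTop (𝓝 0)) (h : ∀ᶠ n in atTop, (law n).real (H n)ᶜ ≤ f n) : AAS H := by
  refine ⟨hm, ?_⟩
  have h1 : Tendsto (fun n => (law n).real (H n)ᶜ) atTop (𝓝 0) :=
    squeeze_zero' (Eventually.of_forall fun n => measureReal_nonneg) h hf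
  have h2 : Tendsto (fun n => (law n).real (H n)) atTop (𝓝 1) := by
    have := h1.const_sub 1
    rw [sub_zero] at this
    refine this.congr fun n => ?_
    rw [probReal_compl_eq_one_sub (hm n)]
    ring
  have h3 := (ENNReal.continuous_ofReal.tendsto 1).comp h2
  rw [ENNReal.ofReal_one] at h3
  refine h3.congr fun n => ?_
  exact ENNReal.ofReal_toReal (measure_ne_top _ _)

end RandomGraphProcess

theorem theorem8 :
    (∀ ω₁ ω₂ : ℕ → ℝ, Tendsto ω₁ atTop atTop → Tendsto ω₂ atTop atTop →
      RandomGraphProcess.AAS fun n => {P |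
        (∀ p : unitInterval,
          (p : ℝ) ≤ (RandomGraphProcess.β *
              (Real.log n - Real.log (Real.log n) / 2) - ω₁ n) / ((n : ℝ) - 1) →
            (RandomGraphProcess.minDeg (RandomGraphProcess.graph P p) : ℝ) ≤
              RandomGraphProcess.dBar (RandomGraphProcess.graph P p) / 2) ∧
        (∀ p : unitInterval,
          (RandomGraphProcess.β *
              (Real.log n - Real.log (Real.log n) / 2) + ω₂ n) / ((n : ℝ) - 1) ≤ (p : ℝ) →
            RandomGraphProcess.dBar (RandomGraphProcess.graph P p) / 2 <
              (RandomGraphProcess.minDeg (RandomGraphProcess.graph P p) : ℝ))}) ∧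
    (∀ θ : ℝ, 0 < θ → θ < 1 → ∃ ρ : ℝ, 0 < ρ ∧
      RandomGraphProcess.AAS fun n => {P |
        ∀ p : unitInterval, ρ * Real.log n / ((n : ℝ) - 1) ≤ (p : ℝ) →
          θ * RandomGraphProcess.dBar (RandomGraphProcess.graph P p) <
            (RandomGraphProcess.minDeg (RandomGraphProcess.graph P p) : ℝ)}) := by
  open RandomGraphProcess in
  refine ⟨fun ω₁ ω₂ h₁ h₂ => ?_, fun θ h0 h1 => ?_⟩
  · obtain ⟨ρ, hρ, hlate⟩ := exists_tendsto_late (θ := 1 / 2) (by norm_num) (by norm_num)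
    have hlim := ((tendsto_below_critDegree h₁).add (tendsto_above_critDegree h₂ hρ)).add hlate
    simp only [add_zero] at hlim
    refine aas_of_compl_le (fun n => ?_) hlim ?_
    · exact (measurableSet_forall_le _ fun G => (minDeg G : ℝ) ≤ dBar G / 2).inter
        (measurableSet_forall_ge _ fun G => dBar G / 2 < (minDeg G : ℝ))
    · filter_upwards [eventually_ge_atTop 2] with n hn
      have hN := natCast_sub_one_pos hn
      refine (measureReal_mono ?_ (measure_ne_top _ _)).trans ((measureReal_union_le _ _).trans
        (add_le_add (measureReal_union_le _ _) le_rfl))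
      intro P hP
      rw [Set.mem_compl_iff, Set.mem_ofPred_eq, not_and_or] at hP
      push Not at hP
      rcases hP with ⟨p, hp, hP⟩ | ⟨p, hp, hP⟩
      · rw [le_div_iff₀' hN] at hp
        exact Or.inl (Or.inl ⟨p, hp, hP⟩)
      · rw [div_le_iff₀' hN] at hp
        rcases le_total (((n : ℝ) - 1) * p) (ρ * Real.log n) with h | h
        · exact Or.inl (Or.inr ⟨p, hp, h, hP⟩)
        · exact Or.inr ⟨p, h, by linarith⟩
  · obtain ⟨ρ, hρ, hlate⟩ := exists_tendsto_late h0 h1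
    refine ⟨ρ, hρ, aas_of_compl_le
      (fun n => measurableSet_forall_ge _ fun G => θ * dBar G < (minDeg G : ℝ)) hlate ?_⟩
    filter_upwards [eventually_ge_atTop 2] with n hn
    refine measureReal_mono ?_ (measure_ne_top _ _)
    intro P hP
    rw [Set.mem_compl_iff, Set.mem_ofPred_eq] at hP
    push Not at hP
    obtain ⟨p, hp, hP⟩ := hP
    rw [div_le_iff₀' (natCast_sub_one_pos hn)] at hp
    exact ⟨p, hp, hP⟩
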